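/- Let $n\ge 2$, $\alpha>0$, $1\le p\le\infty$, $1/p+1/p'=1$ (with $1/\infty=0$), and $\mu,\nu\in\mathbb R$. Let $S^n$ be the unit sphere in $\mathbb R^{n+1}$ with surface area measure $dx$, and $\sigma_{n-1}=2\pi^{n/2}/\Gamma(n/2)$. For $\varphi:S^n\to\mathbb C$ put $$(S^\alpha_+\varphi)(x)=\frac{2}{\Gamma(\alpha)\,\sigma_{n-1}}\int_{\{y\in S^n:\,-1<y_{n+1}<x_{n+1}\}}\frac{(x_{n+1}-y_{n+1})^\alpha}{|x-y|^n}\,\varphi(y)\,dy,$$ $$(S^\alpha_-\varphi)(x)=\frac{2}{\Gamma(\alpha)\,\sigma_{n-1}}\int_{\{y\in S^n:\,x_{n+1}<y_{n+1}<1\}}\frac{(y_{n+1}-x_{n+1})^\alpha}{|x-y|^n}\,\varphi(y)\,dy.$$ For a weight $w$ let $L^p(S^n;w)$ be the space of $f:S^n\to\mathbb C$ with $\|f\|_{L^p(S^n;w)}=\|wf\|_{L^p(S^n)}<\infty$. Let $w(x)=(1+x_{n+1})^\mu(1-x_{n+1})^\nu$ and let $\varepsilon>0$ be arbitrary. (i)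 If $\mu<n/(2p')$, then $S^\alpha_+$ is bounded from $L^p(S^n;w)$ to $L^p(S^n;w_+)$, where $w_+(x)=(1+x_{n+1})^{\mu_+}(1-x_{n+1})^{\nu_+}$, $\mu_+=\mu-\alpha$, and $\nu_+=\nu-\alpha$ if $\nu-\alpha>-n/(2p)$, $\nu_+=-n/(2p)+\varepsilon$ if $\nu-\alpha\le -n/(2p)$. (ii) If $\nu<n/(2p')$, then $S^\alpha_-$ is bounded from $L^p(S^n;w)$ to $L^p(S^n;w_-)$, where $w_-(x)=(1+x_{n+1})^{\mu_-}(1-x_{n+1})^{\nu_-}$, $\nu_-=\nu-\alpha$, and $\mu_-=\mu-\alpha$ if $\mu-\alpha>-n/(2p)$, $\mu_-=-n/(2p)+\varepsilon$ if $\mu-\alpha\le -n/(2p)$. Here boundedness means that for every $\varphi\in L^p(S^n;w)$ the integral defining $S^\alpha_\pm\varphi$ converges absolutely for almost all $x$, and $\|S^\alpha_\pm\varphi\|_{L^p(S^n;w_\pm)}\le C\,\|\varphi\|_{L^p(S^n;w)}$ with $C$ independent of $\varphi$. -/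

import Mathlib

open MeasureTheory
open scoped ENNReal NNReal

noncomputable section

namespace SphericalFrac

/-- The unit sphere `S^n` in the Euclidean space `ℝ^{n+1}`. -/
abbrev Sph (n : ℕ) : Type :=
  Metric.sphere (0 : EuclideanSpace ℝ (Fin (n + 1))) 1

/-- The standard surface area measure on `S^n`. -/
def surf (n : ℕ) : Measure (Sph n) :=
  (volume : Measure (EuclideanSpace ℝ (Fin (n + 1)))).toSphere

/-- The last coordinate `x_{n+1}` of a point of `S^n`. -/
def lastCoord {n : ℕ} (x : Sph n) : ℝ :=
  (x : EuclideanSpace ℝ (Fin (n + 1))) (Fin.last n)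

/-- The spherical segment `{y ∈ S^n : a < y_{n+1} < b}`. -/
def segment (n : ℕ) (a b : ℝ) : Set (Sph n) :=
  {y | a < lastCoord y ∧ lastCoord y < b}

/-- The area `2 π^{n/2} / Γ(n/2)` of the unit sphere `S^{n-1}` in `ℝ^n`. -/
def sphereArea (n : ℕ) : ℝ :=
  2 * Real.pi ^ ((n : ℝ) / 2) / Real.Gamma ((n : ℝ) / 2)

/-- The integrand `(x_{n+1} - y_{n+1})^α |x - y|^{-n} φ(y)` of the left-sided integral. -/
def leftIntegrand {n : ℕ} (α : ℝ) (φ : Sph n → ℂ) (x y : Sph n) : ℂ :=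
  (((lastCoord x - lastCoord y) ^ α /
    ‖(x : EuclideanSpace ℝ (Fin (n + 1))) - y‖ ^ n : ℝ) : ℂ) * φ y

/-- The integrand `(y_{n+1} - x_{n+1})^α |x - y|^{-n} φ(y)` of the right-sided integral. -/
def rightIntegrand {n : ℕ} (α : ℝ) (φ : Sph n → ℂ) (x y : Sph n) : ℂ :=
  (((lastCoord y - lastCoord x) ^ α /
    ‖(x : EuclideanSpace ℝ (Fin (n + 1))) - y‖ ^ n : ℝ) : ℂ) * φ y

/-- The left-sided spherical fractional integral `S^α_{a+} φ`. -/
def leftFrac {n : ℕ} (α a : ℝ) (φ : Sph n → ℂ) (x : Sph n) : ℂ :=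
  ((2 / (Real.Gamma α * sphereArea n) : ℝ) : ℂ) *
    ∫ y in segment n a (lastCoord x), leftIntegrand α φ x y ∂(surf n)

/-- The right-sided spherical fractional integral `S^α_{b-} φ`. -/
def rightFrac {n : ℕ} (α b : ℝ) (φ : Sph n → ℂ) (x : Sph n) : ℂ :=
  ((2 / (Real.Gamma α * sphereArea n) : ℝ) : ℂ) *
    ∫ y in segment n (lastCoord x) b, rightIntegrand α φ x y ∂(surf n)

/-- The integral defining `(S^α_{a+} φ)(x)` exists in the Lebesgue sense. -/
def LeftFracExists {n : ℕ} (α a : ℝ) (φ : Sph n → ℂ) (x : Sph n) : Prop :=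
  IntegrableOn (leftIntegrand α φ x) (segment n a (lastCoord x)) (surf n)

/-- The integral defining `(S^α_{b-} φ)(x)` exists in the Lebesgue sense. -/
def RightFracExists {n : ℕ} (α b : ℝ) (φ : Sph n → ℂ) (x : Sph n) : Prop :=
  IntegrableOn (rightIntegrand α φ x) (segment n (lastCoord x) b) (surf n)

/-- `S^α_+ = S^α_{(-1)+}`. -/
def SPlus {n : ℕ} (α : ℝ) (φ : Sph n → ℂ) : Sph n → ℂ := leftFrac α (-1) φ

/-- `S^α_- = S^α_{1-}`. -/
def SMinus {n : ℕ} (α : ℝ) (φ : Sph n → ℂ) : Sph n → ℂ := rightFrac α 1 φ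

/-- The weight `(1 + x_{n+1})^μ (1 - x_{n+1})^ν`. -/
def weight (n : ℕ) (μ ν : ℝ) (x : Sph n) : ℝ :=
  (1 + lastCoord x) ^ μ * (1 - lastCoord x) ^ ν

/-- `‖f‖_{L^p(S^n; w)} = ‖w f‖_{L^p(S^n)}`. -/
def wNorm {n : ℕ} (p : ℝ≥0∞) (w : Sph n → ℝ) (f : Sph n → ℂ) : ℝ≥0∞ :=
  eLpNorm (fun x => (w x : ℂ) * f x) p (surf n)

/-- `f ∈ L^p(S^n; w)`. -/
def MemWLp {n : ℕ} (p : ℝ≥0∞) (w : Sph n → ℝ) (f : Sph n → ℂ) : Prop :=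
  MemLp (fun x => (w x : ℂ) * f x) p (surf n)

/-- Boundedness from `L^p(S^n; w)` to `L^p(S^n; v)` of an operator `T` given by an integral
formula, where `E φ x` says that the integral defining `T φ` at `x` exists: for every
`φ ∈ L^p(S^n; w)` the function `T φ` is defined almost everywhere and belongs to `L^p(S^n; v)`,
and its norm is at most a constant (independent of `φ`) times the norm of `φ`. -/
def IsBoundedOp {n : ℕ} (T : (Sph n → ℂ) → Sph n → ℂ) (E : (Sph n → ℂ) → Sph n → Prop)
    (p : ℝ≥0∞) (w v : Sph n → ℝ) : Prop :=
  ∃ C : ℝ≥0, ∀ φ : Sph n → ℂ, MemWLp p w φ →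
    (∀ᵐ x ∂(surf n), E φ x) ∧ MemWLp p v (T φ) ∧ wNorm p v (T φ) ≤ C * wNorm p w φ

/-- The exponent that equals `c - α` if `c - α > -n/(2p)`, and `-n/(2p) + ε` otherwise
(with `1/p = 0` for `p = ∞`). -/
def shiftedExp (n : ℕ) (p : ℝ≥0∞) (α c ε : ℝ) : ℝ :=
  if c - α > -((n : ℝ) / 2 * (1 / p).toReal) then c - α
  else -((n : ℝ) / 2 * (1 / p).toReal) + ε

end SphericalFrac

end

/-!
Conjugating with the weights turns the claim into an unweighted `L^p` bound, which is Schur's test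
with the test function `(1 - x_{n+1}^2)^{-n/2}`: one has to integrate powers of `1 ± y_{n+1}`
against the kernel `(x_{n+1} - y_{n+1})_+^α |x - y|^{-n}`. Over a parallel of latitude
`|x - y|^2 = A - B cos θ` with `A^2 - B^2 = 4 (x_{n+1} - y_{n+1})^2`, so the integral of
`|x - y|^{-n}` is controlled by `∫_0^π dθ / (A - B cos θ) = π / √(A^2 - B^2)`. What remains is a
Riemann–Liouville kernel `(t - s)^{α-1}` on `(-1, t)` against powers of `1 + s` and `1 - s`, which
the Möbius map sending `0`, `1`, `∞` to `-1`, `t`, `1` reduces to Beta integrals. The antipodal map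
interchanges the kernel with its transpose, so this one estimate yields both conditions of the test,
for either operator.
-/

namespace SphericalFrac

open Set

section SchurTest

variable {X Y : Type*} [MeasurableSpace X] [MeasurableSpace Y]

/-- The hypothesis of Schur's test for a nonnegative kernel `k` with test functions `V` and `W`.
They enter with the powers `1 / p` and `1 / p'`, so that the endpoints `p = 1` and `p = ∞` need no
separate formulation. -/
structure IsSchurKernel (μ : Measure X) (ν : Measure Y) (p p' : ℝ≥0∞) (k : X → Y → ℝ≥0∞)
    (V : X → ℝ≥0∞) (W : Y → ℝ≥0∞) (C : ℝ≥0) : Prop where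
  measurable : Measurable (Function.uncurry k)
  measurable_left : Measurable V
  measurable_right : Measurable W
  ae_ne_zero_ne_top : ∀ᵐ y ∂ν, W y ≠ 0 ∧ W y ≠ ∞
  lintegral_right_le : ∀ᵐ x ∂μ, ∫⁻ y, k x y * W y ^ (1 / p).toReal ∂ν ≤ C * V x ^ (1 / p).toReal
  lintegral_left_le :
    ∀ᵐ y ∂ν, ∫⁻ x, k x y * V x ^ (1 / p').toReal ∂μ ≤ C * W y ^ (1 / p').toReal

lemma toReal_one_div_add_toReal_one_div (p p' : ℝ≥0∞) [p.HolderConjugate p'] :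
    (1 / p).toReal + (1 / p').toReal = 1 := by
  have hp : p ≠ 0 := ENNReal.HolderConjugate.ne_zero p p'
  have hp' : p' ≠ 0 := ENNReal.HolderConjugate.ne_zero p' p
  rw [← ENNReal.toReal_add (by simpa using hp) (by simpa using hp'), one_div, one_div,
    ENNReal.HolderConjugate.inv_add_inv_eq_one, ENNReal.toReal_one]

lemma lintegral_mul_le_rpow_mul_rpow {ν : Measure Y} {a b r : ℝ} (ha : 0 < a) (hb : 0 ≤ b)
    (hab : a + b = 1) (har : r * a = 1) {k W f : Y → ℝ≥0∞} (hk : Measurable k) (hW : Measurable W)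
    (hf : AEMeasurable f ν) (hW_ae : ∀ᵐ y ∂ν, W y ≠ 0 ∧ W y ≠ ∞) :
    ∫⁻ y, k y * f y ∂ν ≤
      (∫⁻ y, k y * (f y ^ r / W y ^ b) ∂ν) ^ a * (∫⁻ y, k y * W y ^ a ∂ν) ^ b := by
  refine le_trans (lintegral_mono_ae ?_)
    (ENNReal.lintegral_mul_norm_pow_le (by fun_prop) (by fun_prop) ha.le hb hab)
  filter_upwards [hW_ae] with y ⟨hy₀, hy_top⟩
  have hW_cancel : (W y ^ b)⁻¹ ^ a * (W y ^ a) ^ b = 1 := by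
    rw [ENNReal.inv_rpow, ← ENNReal.rpow_mul, ← ENNReal.rpow_mul, mul_comm b a]
    exact ENNReal.inv_mul_cancel (ENNReal.rpow_pos hy₀.bot_lt hy_top).ne'
      (ENNReal.rpow_ne_top_of_ne_zero hy₀ hy_top)
  refine Eq.le ?_
  calc k y * f y = (k y ^ a * k y ^ b) * f y ^ (r * a) * ((W y ^ b)⁻¹ ^ a * (W y ^ a) ^ b) := by
        rw [← ENNReal.rpow_add_of_nonneg _ _ ha.le hb, hab, har, hW_cancel, ENNReal.rpow_one,
          ENNReal.rpow_one, mul_one]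
    _ = (k y * (f y ^ r / W y ^ b)) ^ a * (k y * W y ^ a) ^ b := by
        rw [div_eq_mul_inv, ENNReal.mul_rpow_of_nonneg _ _ ha.le,
          ENNReal.mul_rpow_of_nonneg _ _ ha.le, ENNReal.mul_rpow_of_nonneg _ _ hb, ENNReal.rpow_mul]
        ring

lemma ae_lt_top_of_eLpNorm_lt_top {μ : Measure X} {p : ℝ≥0∞} (hp₀ : p ≠ 0) {f : X → ℝ≥0∞}
    (hf : AEMeasurable f μ) (h : eLpNorm f p μ < ∞) : ∀ᵐ x ∂μ, f x < ∞ := by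
  rcases eq_or_ne p ∞ with rfl | hp
  · filter_upwards [enorm_ae_le_eLpNormEssSup f μ] with x hx
    exact hx.trans_lt (by rwa [eLpNorm_exponent_top] at h)
  · have h_lintegral := lintegral_rpow_enorm_lt_top_of_eLpNorm_lt_top hp₀ hp h
    filter_upwards [ae_lt_top' (hf.enorm.pow_const _) h_lintegral.ne] with x hx
    exact (ENNReal.rpow_lt_top_iff_of_pos (ENNReal.toReal_pos hp₀ hp)).1 hx

namespace IsSchurKernel

variable {μ : Measure X} {ν : Measure Y} {p p' : ℝ≥0∞} {V : X → ℝ≥0∞} {W : Y → ℝ≥0∞} {C : ℝ≥0}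

section NonnegKernel

variable {k : X → Y → ℝ≥0∞} {f : Y → ℝ≥0∞}

lemma eLpNorm_top_lintegral_le (hk : IsSchurKernel μ ν ∞ p' k V W C) (f : Y → ℝ≥0∞) :
    eLpNorm (fun x => ∫⁻ y, k x y * f y ∂ν) ∞ μ ≤ C * eLpNorm f ∞ ν := by
  simp only [eLpNorm_exponent_top]
  refine essSup_le_of_ae_le _ ?_
  filter_upwards [hk.lintegral_right_le] with x hx
  calc ∫⁻ y, k x y * f y ∂ν ≤ ∫⁻ y, k x y * eLpNormEssSup f ν ∂ν := by
        refine lintegral_mono_ae ?_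
        filter_upwards [enorm_ae_le_eLpNormEssSup f ν] with y hy
        exact mul_le_mul_right hy (k x y)
    _ = (∫⁻ y, k x y ∂ν) * eLpNormEssSup f ν :=
        lintegral_mul_const _ (hk.measurable.comp measurable_prodMk_left)
    _ ≤ C * eLpNormEssSup f ν := by
        gcongr
        simpa using hx

lemma ae_lintegral_mul_div_le (hk : IsSchurKernel μ ν p p' k V W C) (g : Y → ℝ≥0∞) :
    ∀ᵐ y ∂ν, ∫⁻ x, V x ^ (1 / p').toReal * (k x y * (g y / W y ^ (1 / p').toReal)) ∂μ
      ≤ C * g y := by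
  filter_upwards [hk.lintegral_left_le, hk.ae_ne_zero_ne_top] with y hy ⟨hy₀, hy_top⟩
  have hky : Measurable fun x => k x y := hk.measurable.comp measurable_prodMk_right
  have hV := hk.measurable_left
  calc ∫⁻ x, V x ^ (1 / p').toReal * (k x y * (g y / W y ^ (1 / p').toReal)) ∂μ
      = (∫⁻ x, k x y * V x ^ (1 / p').toReal ∂μ) * (g y / W y ^ (1 / p').toReal) := by
        rw [← lintegral_mul_const _ (by fun_prop)]
        exact lintegral_congr fun x => by ring
    _ ≤ C * W y ^ (1 / p').toReal * (g y / W y ^ (1 / p').toReal) := by grw [hy]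
    _ = C * g y := by
        rw [mul_assoc, ENNReal.mul_div_cancel (ENNReal.rpow_pos hy₀.bot_lt hy_top).ne'
          (ENNReal.rpow_ne_top_of_ne_zero hy₀ hy_top)]

variable [p.HolderConjugate p']

lemma ae_rpow_lintegral_le (hk : IsSchurKernel μ ν p p' k V W C) (hp : p ≠ ∞)
    (hf : AEMeasurable f ν) : ∀ᵐ x ∂μ, (∫⁻ y, k x y * f y ∂ν) ^ p.toReal ≤
      C ^ ((1 / p').toReal * p.toReal) * ∫⁻ y, V x ^ (1 / p').toReal *
        (k x y * (f y ^ p.toReal / W y ^ (1 / p').toReal)) ∂ν := by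
  filter_upwards [hk.lintegral_right_le] with x hx
  set a := (1 / p).toReal with ha_def
  set b := (1 / p').toReal
  set r := p.toReal
  have hb : 0 ≤ b := ENNReal.toReal_nonneg
  have hr : 0 < r := ENNReal.toReal_pos (ENNReal.HolderConjugate.ne_zero p p') hp
  have har : r * a = 1 := by rw [ha_def, one_div, ENNReal.toReal_inv, mul_inv_cancel₀ hr.ne']
  have ha : 0 < a := pos_of_mul_pos_right (by positivity) hr.le
  have hkx : Measurable (k x) := hk.measurable.comp measurable_prodMk_left
  have hW := hk.measurable_right
  calc (∫⁻ y, k x y * f y ∂ν) ^ r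
      ≤ ((∫⁻ y, k x y * (f y ^ r / W y ^ b) ∂ν) ^ a * (C * V x ^ a) ^ b) ^ r := by
        grw [lintegral_mul_le_rpow_mul_rpow ha hb (toReal_one_div_add_toReal_one_div p p') har hkx
          hW hf hk.ae_ne_zero_ne_top, hx]
    _ = C ^ (b * r) * ∫⁻ y, V x ^ b * (k x y * (f y ^ r / W y ^ b)) ∂ν := by
        rw [lintegral_const_mul'' _ (by fun_prop), ENNReal.mul_rpow_of_nonneg _ _ hr.le,
          ENNReal.mul_rpow_of_nonneg _ _ hb, ENNReal.mul_rpow_of_nonneg _ _ hr.le]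
        simp only [← ENNReal.rpow_mul]
        rw [mul_comm a r, har, ENNReal.rpow_one, show a * b * r = b by linear_combination b * har]
        ring

variable [SFinite μ] [SFinite ν]

lemma lintegral_rpow_lintegral_le (hk : IsSchurKernel μ ν p p' k V W C) (hp : p ≠ ∞)
    (hf : AEMeasurable f ν) :
    ∫⁻ x, (∫⁻ y, k x y * f y ∂ν) ^ p.toReal ∂μ ≤ C ^ p.toReal * ∫⁻ y, f y ^ p.toReal ∂ν := by
  set b := (1 / p').toReal with hb_def
  set r := p.toReal with hr_def
  have hr : 0 < r := ENNReal.toReal_pos (ENNReal.HolderConjugate.ne_zero p p') hp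
  have hbr : r = b * r + 1 := by
    have hsum := toReal_one_div_add_toReal_one_div p p'
    rw [one_div p, ENNReal.toReal_inv, ← hr_def, ← hb_def] at hsum
    field_simp at hsum
    linarith
  have hF : AEMeasurable (Function.uncurry fun x y => V x ^ b * (k x y * (f y ^ r / W y ^ b)))
      (μ.prod ν) := by
    have hk_meas : Measurable fun z : X × Y => k z.1 z.2 := hk.measurable
    have hV := hk.measurable_left
    have hW := hk.measurable_right
    unfold Function.uncurry
    fun_prop
  calc ∫⁻ x, (∫⁻ y, k x y * f y ∂ν) ^ r ∂μ
      ≤ ∫⁻ x, C ^ (b * r) * ∫⁻ y, V x ^ b * (k x y * (f y ^ r / W y ^ b)) ∂ν ∂μ :=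
        lintegral_mono_ae (hk.ae_rpow_lintegral_le hp hf)
    _ = C ^ (b * r) * ∫⁻ y, ∫⁻ x, V x ^ b * (k x y * (f y ^ r / W y ^ b)) ∂μ ∂ν := by
        rw [lintegral_const_mul'' _ hF.lintegral_prod_right, lintegral_lintegral_swap hF]
    _ ≤ C ^ (b * r) * ∫⁻ y, C * f y ^ r ∂ν := by
        grw [lintegral_mono_ae (hk.ae_lintegral_mul_div_le _)]
    _ = C ^ r * ∫⁻ y, f y ^ r ∂ν := by
        have hC : (C : ℝ≥0∞) ^ r = C ^ (b * r) * C := by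
          conv_lhs => rw [hbr]
          rw [ENNReal.rpow_add_of_nonneg _ _ (by positivity) zero_le_one, ENNReal.rpow_one]
        rw [lintegral_const_mul'' _ (by fun_prop), hC, mul_assoc]

theorem eLpNorm_lintegral_le (hk : IsSchurKernel μ ν p p' k V W C) (hf : AEMeasurable f ν) :
    eLpNorm (fun x => ∫⁻ y, k x y * f y ∂ν) p μ ≤ C * eLpNorm f p ν := by
  rcases eq_or_ne p ∞ with rfl | hp
  · exact hk.eLpNorm_top_lintegral_le f
  have hp₀ : p ≠ 0 := ENNReal.HolderConjugate.ne_zero p p'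
  have hr : 0 < p.toReal := ENNReal.toReal_pos hp₀ hp
  simp only [eLpNorm_eq_lintegral_rpow_enorm_toReal hp₀ hp, enorm_eq_self]
  grw [hk.lintegral_rpow_lintegral_le hp hf]
  rw [ENNReal.mul_rpow_of_nonneg _ _ (by positivity), ← ENNReal.rpow_mul,
    mul_one_div_cancel hr.ne', ENNReal.rpow_one]

end NonnegKernel

section RealKernel

variable {E : Type*} [NormedAddCommGroup E] [NormedSpace ℝ E] {κ : X → Y → ℝ} {f : Y → E}
  [p.HolderConjugate p'] [SFinite μ] [SFinite ν]

lemma eLpNorm_lintegral_enorm_smul_le (hκ : IsSchurKernel μ ν p p' (fun x y => ‖κ x y‖ₑ) V W C)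
    (hf : AEStronglyMeasurable f ν) :
    eLpNorm (fun x => ∫⁻ y, ‖κ x y • f y‖ₑ ∂ν) p μ ≤ C * eLpNorm f p ν := by
  simp only [enorm_smul]
  exact (hκ.eLpNorm_lintegral_le hf.enorm).trans_eq (by rw [eLpNorm_enorm])

theorem ae_integrable_smul (hκ : IsSchurKernel μ ν p p' (fun x y => ‖κ x y‖ₑ) V W C)
    (hκ_meas : Measurable (Function.uncurry κ)) (hf : MemLp f p ν) :
    ∀ᵐ x ∂μ, Integrable (fun y => κ x y • f y) ν := by
  have h_meas : AEMeasurable (fun x => ∫⁻ y, ‖κ x y • f y‖ₑ ∂ν) μ :=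
    (hκ_meas.aestronglyMeasurable.smul hf.1.comp_snd).enorm.lintegral_prod_right
  have h_top : eLpNorm (fun x => ∫⁻ y, ‖κ x y • f y‖ₑ ∂ν) p μ < ∞ :=
    (hκ.eLpNorm_lintegral_enorm_smul_le hf.1).trans_lt (ENNReal.mul_lt_top (by simp) hf.2)
  filter_upwards [ae_lt_top_of_eLpNorm_lt_top (ENNReal.HolderConjugate.ne_zero p p') h_meas h_top]
    with x hx
  exact ⟨(hκ_meas.comp measurable_prodMk_left).aestronglyMeasurable.smul hf.1, hx⟩

theorem eLpNorm_integral_smul_le (hκ : IsSchurKernel μ ν p p' (fun x y => ‖κ x y‖ₑ) V W C)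
    (hf : AEStronglyMeasurable f ν) :
    eLpNorm (fun x => ∫ y, κ x y • f y ∂ν) p μ ≤ C * eLpNorm f p ν :=
  (eLpNorm_mono_enorm fun _ => enorm_integral_le_lintegral_enorm _).trans
    (hκ.eLpNorm_lintegral_enorm_smul_le hf)

theorem memLp_integral_smul (hκ : IsSchurKernel μ ν p p' (fun x y => ‖κ x y‖ₑ) V W C)
    (hκ_meas : Measurable (Function.uncurry κ)) (hf : MemLp f p ν) :
    MemLp (fun x => ∫ y, κ x y • f y ∂ν) p μ :=
  ⟨(hκ_meas.aestronglyMeasurable.smul hf.1.comp_snd).integral_prod_right',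
    (hκ.eLpNorm_integral_smul_le hf.1).trans_lt (ENNReal.mul_lt_top (by simp) hf.2)⟩

end RealKernel

end IsSchurKernel
end SchurTest

section RiemannLiouville

variable {l t r w : ℝ}

/-- The Möbius transformation sending `0`, `1`, `∞` to `l`, `t`, `r`. -/
noncomputable def moebius (l t r w : ℝ) : ℝ := l + (t - l) * (r - l) * w / (r - t + (t - l) * w)

lemma moebius_denom_pos (hlt : l < t) (htr : t < r) (hw : 0 < w) : 0 < r - t + (t - l) * w :=
  add_pos (sub_pos.2 htr) (mul_pos (sub_pos.2 hlt) hw)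

lemma moebius_sub_left (l t r w : ℝ) :
    moebius l t r w - l = (t - l) * (r - l) * w / (r - t + (t - l) * w) := by
  rw [moebius, add_sub_cancel_left]

lemma sub_moebius_mid (hlt : l < t) (htr : t < r) (hw : 0 < w) :
    t - moebius l t r w = (t - l) * (r - t) * (1 - w) / (r - t + (t - l) * w) := by
  have hD := moebius_denom_pos hlt htr hw
  rw [moebius]
  field_simp
  ring

lemma sub_moebius_right (hlt : l < t) (htr : t < r) (hw : 0 < w) :
    r - moebius l t r w = (r - t) * (r - l) / (r - t + (t - l) * w) := by
  have hD := moebius_denom_pos hlt htr hw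
  rw [moebius]
  field_simp
  ring

lemma hasDerivAt_moebius (hlt : l < t) (htr : t < r) (hw : 0 < w) :
    HasDerivAt (moebius l t r)
      ((t - l) * (r - t) * (r - l) / (r - t + (t - l) * w) ^ 2) w := by
  have hD := moebius_denom_pos hlt htr hw
  have h_num : HasDerivAt (fun w => (t - l) * (r - l) * w) ((t - l) * (r - l)) w := by
    simpa using (hasDerivAt_id w).const_mul ((t - l) * (r - l))
  have h_den : HasDerivAt (fun w => r - t + (t - l) * w) (t - l) w := by
    simpa using ((hasDerivAt_id w).const_mul (t - l)).const_add (r - t)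
  refine ((h_num.div h_den hD.ne').const_add l).congr_deriv ?_
  ring

/-- The cross ratio, which is the inverse of `moebius`. -/
noncomputable def crossRatio (l t r s : ℝ) : ℝ := (s - l) * (r - t) / ((r - s) * (t - l))

lemma crossRatio_moebius (hlt : l < t) (htr : t < r) (hw : 0 < w) :
    crossRatio l t r (moebius l t r w) = w := by
  have h₁ := sub_pos.2 hlt
  have h₂ := sub_pos.2 htr
  have h₃ := sub_pos.2 (hlt.trans htr)
  rw [crossRatio, moebius_sub_left, sub_moebius_right hlt htr hw]
  field_simp

lemma moebius_crossRatio {s : ℝ} (hlt : l < t) (htr : t < r) (hs : s < r) :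
    moebius l t r (crossRatio l t r s) = s := by
  have h₁ := sub_pos.2 hlt
  have h₃ := sub_pos.2 (hlt.trans htr)
  have h₄ := sub_pos.2 hs
  have h_den : r - t + (t - l) * crossRatio l t r s = (r - t) * (r - l) / (r - s) := by
    rw [crossRatio]
    field_simp
    ring
  have h₂ := sub_pos.2 htr
  rw [moebius, h_den, crossRatio]
  field_simp
  ring

lemma crossRatio_mem_Ioo {s : ℝ} (htr : t < r) (hs : s ∈ Ioo l t) :
    crossRatio l t r s ∈ Ioo 0 1 := by
  have h₁ := sub_pos.2 (hs.1.trans hs.2)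
  have h₃ := sub_pos.2 hs.1
  have h₄ := sub_pos.2 (hs.2.trans htr)
  refine ⟨by rw [crossRatio]; positivity, (div_lt_one (by positivity)).2 ?_⟩
  nlinarith [hs.2, h₃]

lemma setLIntegral_Ioo_le_comp_moebius (hlt : l < t) (htr : t < r) (g : ℝ → ℝ≥0∞) :
    ∫⁻ s in Ioo l t, g s ≤ ∫⁻ w in Ioo 0 1,
      ENNReal.ofReal ((t - l) * (r - t) * (r - l) / (r - t + (t - l) * w) ^ 2) *
        g (moebius l t r w) := by
  have h_image : Ioo l t ⊆ moebius l t r '' Ioo 0 1 := fun s hs =>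
    ⟨_, crossRatio_mem_Ioo htr hs, moebius_crossRatio hlt htr (hs.2.trans htr)⟩
  refine (lintegral_mono_set h_image).trans_eq ?_
  rw [lintegral_image_eq_lintegral_abs_deriv_mul measurableSet_Ioo
    (fun w hw => (hasDerivAt_moebius hlt htr hw.1).hasDerivWithinAt)
    (LeftInvOn.injOn fun w hw => crossRatio_moebius hlt htr hw.1)]
  refine setLIntegral_congr_fun measurableSet_Ioo fun w hw => ?_
  have h₃ := sub_pos.2 (hlt.trans htr)
  have hD := moebius_denom_pos hlt htr hw.1
  simp only [abs_of_pos (by positivity :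
    0 < (t - l) * (r - t) * (r - l) / (r - t + (t - l) * w) ^ 2)]

lemma lintegral_Ioo_rpow_mul_one_sub_rpow_lt_top {a b : ℝ} (ha : 0 < a) (hb : 0 < b) :
    ∫⁻ w in Ioo (0 : ℝ) 1, ENNReal.ofReal (w ^ (a - 1) * (1 - w) ^ (b - 1)) < ∞ := by
  have hB := ProbabilityTheory.beta_pos ha hb
  have h_one := ProbabilityTheory.lintegral_betaPDF_eq_one ha hb
  simp only [ProbabilityTheory.lintegral_betaPDF, mul_assoc,
    ENNReal.ofReal_mul (one_div_pos.2 hB).le] at h_one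
  rw [lintegral_const_mul _ (by fun_prop)] at h_one
  exact ENNReal.lt_top_of_mul_ne_top_right (h_one.trans_ne ENNReal.one_ne_top) (by simpa using hB)

lemma rpow_le_one_add_rpow {x w : ℝ} (hw : 0 < w) (hwx : w ≤ x) (hx : x ≤ 1) (e : ℝ) :
    x ^ e ≤ 1 + w ^ e := by
  have hx₀ := hw.trans_le hwx
  rcases le_total 0 e with he | he
  · linarith [Real.rpow_le_one hx₀.le hx he, Real.rpow_nonneg hw.le e]
  · linarith [Real.rpow_le_rpow_of_nonpos hw hwx he]

lemma riemannLiouville_integrand_comp_moebius {α c d : ℝ} (hlt : l < t) (htr : t < r)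
    (hw : w ∈ Ioo (0 : ℝ) 1) :
    (t - l) * (r - t) * (r - l) / (r - t + (t - l) * w) ^ 2 *
        ((t - moebius l t r w) ^ (α - 1) * (moebius l t r w - l) ^ (c - 1) *
          (r - moebius l t r w) ^ (-d)) =
      (t - l) ^ (α + c - 1) * (r - t) ^ (α - d) * (r - l) ^ (-α) *
        (((r - t + (t - l) * w) / (r - l)) ^ (d - α - c) * (w ^ (c - 1) * (1 - w) ^ (α - 1))) := by
  have h₁ := sub_pos.2 hlt
  have h₂ := sub_pos.2 htr
  have h₃ := sub_pos.2 (hlt.trans htr)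
  have hw₀ := hw.1
  have hw₁ := sub_pos.2 hw.2
  have hD := moebius_denom_pos hlt htr hw.1
  rw [moebius_sub_left, sub_moebius_mid hlt htr hw.1, sub_moebius_right hlt htr hw.1]
  generalize r - t + (t - l) * w = D at *
  generalize t - l = a at *
  generalize r - t = b at *
  generalize r - l = L at *
  generalize 1 - w = v at *
  have ha : a ^ (α + c - 1) = a * a ^ (α - 1) * a ^ (c - 1) := by
    rw [show α + c - 1 = 1 + (α - 1) + (c - 1) by ring, Real.rpow_add h₁, Real.rpow_add h₁,
      Real.rpow_one]
  have hb : b ^ (α - d) = b * b ^ (α - 1) * b ^ (-d) := by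
    rw [show α - d = 1 + (α - 1) + -d by ring, Real.rpow_add h₂, Real.rpow_add h₂, Real.rpow_one]
  have hL : L ^ (-α) = L ^ (d - α - c) * (L * L ^ (c - 1) * L ^ (-d)) := by
    rw [show -α = d - α - c + (1 + (c - 1) + -d) by ring, Real.rpow_add h₃, Real.rpow_add h₃,
      Real.rpow_add h₃, Real.rpow_one]
  have hD' : D ^ (d - α - c) = (D ^ 2 * (D ^ (α - 1) * D ^ (c - 1) * D ^ (-d)))⁻¹ := by
    rw [show d - α - c = -(2 + (α - 1 + (c - 1) + -d)) by ring, Real.rpow_neg hD.le,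
      Real.rpow_add hD, Real.rpow_add hD, Real.rpow_add hD, Real.rpow_two]
  rw [Real.div_rpow (by positivity) hD.le, Real.div_rpow (by positivity) hD.le,
    Real.div_rpow (by positivity) hD.le, Real.div_rpow hD.le h₃.le,
    Real.mul_rpow (by positivity) hw₁.le, Real.mul_rpow h₁.le h₂.le,
    Real.mul_rpow (by positivity) hw₀.le, Real.mul_rpow h₁.le h₃.le, Real.mul_rpow h₂.le h₃.le,
    ha, hb, hL, hD']
  field_simp

theorem exists_lintegral_riemannLiouville_le {α c d : ℝ} (hα : 0 < α) (hc : 0 < c) (hd : α < d) :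
    ∃ C : ℝ≥0, ∀ l t r : ℝ, l < t → t < r →
      ∫⁻ s in Ioo l t, ENNReal.ofReal ((t - s) ^ (α - 1) * (s - l) ^ (c - 1) * (r - s) ^ (-d)) ≤
        C * ENNReal.ofReal ((t - l) ^ (α + c - 1) * (r - t) ^ (α - d) * (r - l) ^ (-α)) := by
  obtain ⟨C, hC, -⟩ := ENNReal.lt_iff_exists_coe.1 (ENNReal.add_lt_top.2
    ⟨lintegral_Ioo_rpow_mul_one_sub_rpow_lt_top hc hα,
    lintegral_Ioo_rpow_mul_one_sub_rpow_lt_top (sub_pos.2 hd) hα⟩)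
  refine ⟨C, fun l t r hlt htr => ?_⟩
  rw [← hC, mul_comm (_ + _), ← lintegral_add_left (by fun_prop),
    ← lintegral_const_mul _ (by fun_prop)]
  refine (setLIntegral_Ioo_le_comp_moebius hlt htr _).trans
    (setLIntegral_mono (by fun_prop) fun w hw => ?_)
  have h₃ := sub_pos.2 (hlt.trans htr)
  have hw₀ := hw.1
  have hw₁ := sub_pos.2 hw.2
  have h_ratio : ((r - t + (t - l) * w) / (r - l)) ^ (d - α - c) ≤ 1 + w ^ (d - α - c) := by
    refine rpow_le_one_add_rpow hw₀ ?_ ?_ _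
    · rw [le_div_iff₀ h₃]
      nlinarith
    · rw [div_le_one h₃]
      nlinarith
  have h_split : w ^ (d - α - c) * w ^ (c - 1) = w ^ (d - α - 1) := by
    rw [← Real.rpow_add hw₀]
    ring_nf
  rw [← ENNReal.ofReal_mul (by positivity), riemannLiouville_integrand_comp_moebius hlt htr hw,
    ← ENNReal.ofReal_add (by positivity) (by positivity), ← ENNReal.ofReal_mul (by positivity)]
  gcongr
  calc _ ≤ (1 + w ^ (d - α - c)) * (w ^ (c - 1) * (1 - w) ^ (α - 1)) := by gcongr
    _ = _ := by rw [← h_split]; ring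

end RiemannLiouville

section HalfAngle

open Real

lemma lintegral_Ioi_inv_one_add_sq :
    ∫⁻ v in Ioi (0 : ℝ), ENNReal.ofReal (1 + v ^ 2)⁻¹ = ENNReal.ofReal (π / 2) := by
  rw [← ofReal_integral_eq_lintegral_ofReal integrable_inv_one_add_sq.integrableOn
    (ae_of_all _ fun v => by positivity), integral_Ioi_inv_one_add_sq, arctan_zero, sub_zero]

lemma image_two_mul_arctan_mul {c : ℝ} (hc : 0 < c) :
    (fun v => 2 * arctan (c * v)) '' Ioi 0 = Ioo 0 π := by
  ext θ
  constructor
  · rintro ⟨v, hv, rfl⟩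
    have h₀ : 0 < arctan (c * v) := arctan_pos.2 (mul_pos hc hv)
    have h₁ := arctan_lt_pi_div_two (c * v)
    constructor <;> dsimp only <;> linarith
  · rintro ⟨h₀, h₁⟩
    refine ⟨tan (θ / 2) / c, div_pos (tan_pos_of_pos_of_lt_pi_div_two ?_ ?_) hc, ?_⟩
    · linarith
    · linarith
    · dsimp only
      rw [mul_div_cancel₀ _ hc.ne', arctan_tan (by linarith) (by linarith)]
      ring

lemma cos_two_mul_arctan (x : ℝ) : cos (2 * arctan x) = (1 - x ^ 2) / (1 + x ^ 2) := by
  have : 0 < 1 + x ^ 2 := by positivity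
  rw [cos_two_mul, cos_sq_arctan]
  field_simp
  ring

lemma lintegral_Ioo_inv_sub_mul_cos {A B : ℝ} (hB : |B| < A) :
    ∫⁻ θ in Ioo 0 π, ENNReal.ofReal (A - B * cos θ)⁻¹ = ENNReal.ofReal (π / √(A ^ 2 - B ^ 2)) := by
  obtain ⟨hB₁, hB₂⟩ := abs_lt.1 hB
  have hv : 0 < A + B := by linarith
  set c := √((A - B) / (A + B)) with hc_def
  have hc : 0 < c := by positivity
  have hc_sq : (A + B) * c ^ 2 = A - B := by
    rw [hc_def, sq_sqrt (by positivity)]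
    field_simp
  have h_const : 2 * c / (A - B) = 2 / √(A ^ 2 - B ^ 2) := by
    rw [show A ^ 2 - B ^ 2 = ((A + B) * c) ^ 2 by linear_combination (-(A + B)) * hc_sq,
      sqrt_sq (by positivity), ← hc_sq]
    field_simp
  have h_deriv (v : ℝ) :
      HasDerivAt (fun v => 2 * arctan (c * v)) (2 * (1 / (1 + (c * v) ^ 2) * c)) v := by
    simpa using (((hasDerivAt_id v).const_mul c).arctan).const_mul 2
  have h_inj : InjOn (fun v => 2 * arctan (c * v)) (Ioi 0) := fun x _ y _ hxy =>
    mul_left_cancel₀ hc.ne' (arctan_injective (mul_left_cancel₀ two_ne_zero hxy))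
  rw [← image_two_mul_arctan_mul hc, lintegral_image_eq_lintegral_abs_deriv_mul measurableSet_Ioi
    (fun v _ => (h_deriv v).hasDerivWithinAt) h_inj]
  calc _ = ∫⁻ v in Ioi (0 : ℝ), ENNReal.ofReal (2 / √(A ^ 2 - B ^ 2)) *
        ENNReal.ofReal (1 + v ^ 2)⁻¹ := by
        refine lintegral_congr fun v => ?_
        rw [← ENNReal.ofReal_mul (abs_nonneg _), ← ENNReal.ofReal_mul (by positivity),
          abs_of_pos (by positivity), cos_two_mul_arctan, ← h_const]
        congr 1
        have h_denom : A - B * ((1 - (c * v) ^ 2) / (1 + (c * v) ^ 2)) =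
            (A - B) * (1 + v ^ 2) / (1 + (c * v) ^ 2) := by
          field_simp
          linear_combination v ^ 2 * hc_sq
        rw [h_denom]
        field_simp
    _ = ENNReal.ofReal (π / √(A ^ 2 - B ^ 2)) := by
        rw [lintegral_const_mul _ (by fun_prop), lintegral_Ioi_inv_one_add_sq,
          ← ENNReal.ofReal_mul (by positivity)]
        congr 1
        ring

lemma mul_sin_sq_le {A B : ℝ} (hB : |B| ≤ A) (θ : ℝ) : A * sin θ ^ 2 ≤ 2 * (A - B * cos θ) := by
  have hA : 0 ≤ A := (abs_nonneg B).trans hB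
  have h_cos : B * cos θ ≤ A * |cos θ| :=
    (le_abs_self _).trans ((abs_mul B _).trans_le (by gcongr))
  have h_sq : 0 ≤ A * (1 - |cos θ|) ^ 2 := by positivity
  rw [sin_sq, ← sq_abs (cos θ)]
  linarith

lemma sin_pow_mul_rpow_le {A B θ : ℝ} (hB : |B| < A) (hθ : θ ∈ Ioo 0 π) (k : ℕ) :
    sin θ ^ k * (A - B * cos θ) ^ (-((k + 2 : ℝ) / 2)) ≤
      (2 / A) ^ ((k : ℝ) / 2) * (A - B * cos θ)⁻¹ := by
  have hA : 0 < A := (abs_nonneg B).trans_lt hB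
  have hs : 0 < sin θ := sin_pos_of_mem_Ioo hθ
  have h_sq : sin θ ^ 2 ≤ 2 / A * (A - B * cos θ) := by
    rw [div_mul_eq_mul_div, le_div_iff₀ hA, mul_comm]
    exact mul_sin_sq_le hB.le θ
  have hM : 0 < A - B * cos θ :=
    pos_of_mul_pos_right ((pow_pos hs 2).trans_le h_sq) (by positivity)
  calc sin θ ^ k * (A - B * cos θ) ^ (-((k + 2 : ℝ) / 2))
      = (sin θ ^ 2) ^ ((k : ℝ) / 2) * (A - B * cos θ) ^ (-((k + 2 : ℝ) / 2)) := by
        rw [← rpow_natCast _ 2, ← rpow_mul hs.le, ← rpow_natCast]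
        congr 2
        push_cast
        ring
    _ ≤ (2 / A * (A - B * cos θ)) ^ ((k : ℝ) / 2) * (A - B * cos θ) ^ (-((k + 2 : ℝ) / 2)) := by
        gcongr
    _ = (2 / A) ^ ((k : ℝ) / 2) * (A - B * cos θ)⁻¹ := by
        rw [mul_rpow (by positivity) hM.le, mul_assoc, ← rpow_add hM, ← rpow_neg_one]
        congr 2
        ring

lemma lintegral_Ioo_sin_pow_mul_rpow_le {A B : ℝ} (hB : |B| < A) (k : ℕ) :
    ∫⁻ θ in Ioo 0 π, ENNReal.ofReal (sin θ ^ k) *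
        ENNReal.ofReal ((A - B * cos θ) ^ (-((k + 2 : ℝ) / 2))) ≤
      ENNReal.ofReal ((2 / A) ^ ((k : ℝ) / 2) * (π / √(A ^ 2 - B ^ 2))) := by
  have hA : 0 < A := (abs_nonneg B).trans_lt hB
  rw [ENNReal.ofReal_mul (by positivity), ← lintegral_Ioo_inv_sub_mul_cos hB,
    ← lintegral_const_mul _ (by fun_prop)]
  refine setLIntegral_mono (by fun_prop) fun θ hθ => ?_
  rw [← ENNReal.ofReal_mul (pow_nonneg (sin_pos_of_mem_Ioo hθ).le k),
    ← ENNReal.ofReal_mul (by positivity)]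
  exact ENNReal.ofReal_le_ofReal (sin_pow_mul_rpow_le hB hθ k)

end HalfAngle

section PolarCoordinates

open Module Measure

section NormedSpace

variable {E : Type*} [NormedAddCommGroup E] [NormedSpace ℝ E] [FiniteDimensional ℝ E]
  [MeasurableSpace E] [BorelSpace E]

theorem lintegral_eq_lintegral_toSphere [Nontrivial E] (μ : Measure E) [μ.IsAddHaarMeasure]
    {F : E → ℝ≥0∞} (hF : Measurable F) :
    ∫⁻ x, F x ∂μ = ∫⁻ ω, (∫⁻ r in Ioi (0 : ℝ), ENNReal.ofReal (r ^ (finrank ℝ E - 1)) *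
      F (r • (ω : E))) ∂μ.toSphere := by
  have h_polar := MeasurePreserving.symm (homeomorphUnitSphereProd E).toMeasurableEquiv
    μ.measurePreserving_homeomorphUnitSphereProd
  calc ∫⁻ x, F x ∂μ = ∫⁻ x : ({0}ᶜ : Set E), F x ∂μ.comap Subtype.val := by
        rw [lintegral_subtype_comap (measurableSet_singleton _).compl, restrict_compl_singleton]
    _ = ∫⁻ q : Metric.sphere (0 : E) 1 × Ioi (0 : ℝ), F (q.2.1 • (q.1 : E))
          ∂μ.toSphere.prod (volumeIoiPow (finrank ℝ E - 1)) := by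
        rw [← h_polar.lintegral_comp_emb (MeasurableEquiv.measurableEmbedding _)]
        rfl
    _ = ∫⁻ ω, ∫⁻ r : Ioi (0 : ℝ), F (r.1 • (ω : E)) ∂volumeIoiPow (finrank ℝ E - 1)
          ∂μ.toSphere := lintegral_prod _ (by fun_prop)
    _ = _ := by
        refine lintegral_congr fun ω => ?_
        rw [volumeIoiPow, lintegral_withDensity_eq_lintegral_mul _ (by fun_prop) (by fun_prop)]
        exact lintegral_subtype_comap measurableSet_Ioi
          fun r : ℝ => ENNReal.ofReal (r ^ (finrank ℝ E - 1)) * F (r • (ω : E))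

lemma lintegral_Ioi_pow_mul_indicator (d : ℕ) (c : ℝ≥0∞) :
    ∫⁻ r in Ioi (0 : ℝ), ENNReal.ofReal (r ^ d) *
      (c * (Iio (1 : ℝ)).indicator (fun r => ENNReal.ofReal (r ^ d)⁻¹) r) = c := by
  calc _ = ∫⁻ r in Ioi (0 : ℝ), (Iio (1 : ℝ)).indicator (fun _ => c) r := by
        refine setLIntegral_congr_fun measurableSet_Ioi fun r (hr : 0 < r) => ?_
        by_cases h : r ∈ Iio (1 : ℝ)
        · simp only [indicator_of_mem h]
          rw [mul_left_comm, ← ENNReal.ofReal_mul (by positivity), mul_inv_cancel₀ (by positivity),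
            ENNReal.ofReal_one, mul_one]
        · simp only [indicator_of_notMem h, mul_zero]
    _ = c := by
        rw [lintegral_indicator_const measurableSet_Iio, Measure.restrict_apply measurableSet_Iio,
          Iio_inter_Ioi, Real.volume_Ioo, sub_zero, ENNReal.ofReal_one, mul_one]

lemma exists_measurable_radial_extension {f : Metric.sphere (0 : E) 1 → ℝ≥0∞} (hf : Measurable f)
    (d : ℕ) : ∃ F : E → ℝ≥0∞, Measurable F ∧
      ∀ ω : Metric.sphere (0 : E) 1,
        ∫⁻ r in Ioi (0 : ℝ), ENNReal.ofReal (r ^ d) * F (r • (ω : E)) = f ω := by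
  obtain ⟨g, hg, hgf⟩ := (MeasurableEmbedding.subtype_coe
    Metric.isClosed_sphere.measurableSet).exists_measurable_extend hf fun _ => ⟨0⟩
  refine ⟨fun x => g (‖x‖⁻¹ • x) *
    (Iio (1 : ℝ)).indicator (fun r => ENNReal.ofReal (r ^ d)⁻¹) ‖x‖, ?_, fun ω => ?_⟩
  · have : Measurable ((Iio (1 : ℝ)).indicator fun r => ENNReal.ofReal (r ^ d)⁻¹) :=
      Measurable.indicator (by fun_prop) measurableSet_Iio
    fun_prop
  · rw [← lintegral_Ioi_pow_mul_indicator d (f ω)]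
    refine setLIntegral_congr_fun measurableSet_Ioi fun r (hr : 0 < r) => ?_
    have h_norm : ‖r • (ω : E)‖ = r := by
      rw [norm_smul, norm_eq_of_mem_sphere, mul_one, Real.norm_of_nonneg hr.le]
    simp only [h_norm, ← congrFun hgf ω, Function.comp_apply, smul_smul, inv_mul_cancel₀ hr.ne',
      one_smul]

end NormedSpace

section HalfPlane

open Real

lemma polarCoord_target_inter_preimage :
    polarCoord.target ∩ {q | 0 < q.1 * sin q.2} = Ioi 0 ×ˢ Ioo 0 π := by
  ext ⟨r, θ⟩
  constructor
  · rintro ⟨⟨hr, hπθ, hθπ⟩, h_sin⟩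
    refine ⟨hr, ?_, hθπ⟩
    by_contra! hθ
    exact (pos_of_mul_pos_right h_sin (le_of_lt hr)).not_ge
      (sin_nonpos_of_nonpos_of_neg_pi_le hθ hπθ.le)
  · rintro ⟨hr, hθ⟩
    exact ⟨⟨hr, (neg_lt_zero.2 pi_pos).trans hθ.1, hθ.2⟩, mul_pos hr (sin_pos_of_mem_Ioo hθ)⟩

lemma lintegral_halfPlane_polarCoord {G : ℝ × ℝ → ℝ≥0∞} (hG : Measurable G) :
    ∫⁻ ρ in Ioi 0, ∫⁻ z, G (z, ρ) =
      ∫⁻ θ in Ioo 0 π, ∫⁻ r in Ioi 0, ENNReal.ofReal r * G (r * cos θ, r * sin θ) := by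
  have h_polar : Measurable fun q : ℝ × ℝ =>
      ENNReal.ofReal q.1 * G (q.1 * cos q.2, q.1 * sin q.2) := by
    fun_prop
  have h_meas : MeasurableSet {q : ℝ × ℝ | 0 < q.1 * sin q.2} :=
    measurableSet_lt measurable_const (by fun_prop)
  calc ∫⁻ ρ in Ioi 0, ∫⁻ z, G (z, ρ) = ∫⁻ q in univ ×ˢ Ioi 0, G q := by
        rw [volume_eq_prod, ← prod_restrict, restrict_univ, lintegral_prod_symm _ hG.aemeasurable]
    _ = ∫⁻ q in polarCoord.target, ENNReal.ofReal q.1 •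
          (univ ×ˢ Ioi 0).indicator G (polarCoord.symm q) := by
        rw [lintegral_comp_polarCoord_symm,
          lintegral_indicator (MeasurableSet.univ.prod measurableSet_Ioi)]
    _ = ∫⁻ q in polarCoord.target, {q : ℝ × ℝ | 0 < q.1 * sin q.2}.indicator
          (fun q => ENNReal.ofReal q.1 * G (q.1 * cos q.2, q.1 * sin q.2)) q := by
        refine lintegral_congr fun q => ?_
        simp only [indicator, polarCoord_symm_apply, mem_prod, mem_univ, true_and, mem_Ioi,
          mem_ofPred_eq, smul_eq_mul, mul_ite, mul_zero]
    _ = ∫⁻ q in Ioi 0 ×ˢ Ioo 0 π, ENNReal.ofReal q.1 * G (q.1 * cos q.2, q.1 * sin q.2) := by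
        rw [lintegral_indicator h_meas, restrict_restrict h_meas, inter_comm,
          polarCoord_target_inter_preimage]
    _ = _ := by
        rw [volume_eq_prod, ← prod_restrict, lintegral_prod_symm _ h_polar.aemeasurable]

end HalfPlane

end PolarCoordinates

section Sphere

open Real

variable {n : ℕ}

/-- The point `(x, z)` of `ℝ^{n+1} = ℝ^n × ℝ`. -/
noncomputable def joinLast (x : EuclideanSpace ℝ (Fin n)) (z : ℝ) :
    EuclideanSpace ℝ (Fin (n + 1)) :=
  WithLp.toLp 2 (Fin.snoc (WithLp.ofLp x) z)

@[simp]
lemma joinLast_last (x : EuclideanSpace ℝ (Fin n)) (z : ℝ) : joinLast x z (Fin.last n) = z := by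
  simp [joinLast]

@[simp]
lemma joinLast_castSucc (x : EuclideanSpace ℝ (Fin n)) (z : ℝ) (i : Fin n) :
    joinLast x z i.castSucc = x i := by
  simp [joinLast]

lemma joinLast_init (x : EuclideanSpace ℝ (Fin (n + 1))) :
    joinLast (WithLp.toLp 2 fun i => x i.castSucc) (x (Fin.last n)) = x := by
  ext i
  refine Fin.lastCases ?_ (fun i => ?_) i <;> simp

lemma smul_joinLast (r : ℝ) (x : EuclideanSpace ℝ (Fin n)) (z : ℝ) :
    r • joinLast x z = joinLast (r • x) (r * z) := by
  ext i
  refine Fin.lastCases ?_ (fun i => ?_) i <;> simp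

lemma inner_joinLast (x y : EuclideanSpace ℝ (Fin n)) (z w : ℝ) :
    inner ℝ (joinLast x z) (joinLast y w) = inner ℝ x y + z * w := by
  simp [PiLp.inner_apply, Fin.sum_univ_castSucc, mul_comm]

lemma norm_joinLast_sq (x : EuclideanSpace ℝ (Fin n)) (z : ℝ) :
    ‖joinLast x z‖ ^ 2 = ‖x‖ ^ 2 + z ^ 2 := by
  rw [← real_inner_self_eq_norm_sq, inner_joinLast, real_inner_self_eq_norm_sq, sq z]

lemma measurePreserving_joinLast (n : ℕ) :
    MeasurePreserving fun q : ℝ × EuclideanSpace ℝ (Fin n) => joinLast q.2 q.1 := by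
  have h_insert : (fun q : ℝ × EuclideanSpace ℝ (Fin n) => joinLast q.2 q.1) =
      WithLp.toLp 2 ∘ (MeasurableEquiv.piFinSuccAbove (fun _ => ℝ) (Fin.last n)).symm ∘
        Prod.map id WithLp.ofLp := by
    ext q i
    simp [joinLast, MeasurableEquiv.piFinSuccAbove]
  rw [h_insert]
  exact (PiLp.volume_preserving_toLp (Fin (n + 1))).comp
    ((volume_preserving_piFinSuccAbove (fun _ => ℝ) (Fin.last n)).symm.comp
      ((MeasurePreserving.id volume).prod (PiLp.volume_preserving_ofLp (Fin n))))

@[fun_prop]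
lemma measurable_joinLast {β : Type*} [MeasurableSpace β] {f : β → EuclideanSpace ℝ (Fin n)}
    {g : β → ℝ} (hf : Measurable f) (hg : Measurable g) :
    Measurable fun b => joinLast (f b) (g b) :=
  (measurePreserving_joinLast n).measurable.comp (hg.prodMk hf)

/-- The point of `S^{n+1}` with polar angle `θ`, measured from the pole `(0, …, 0, 1)`, in the
direction `η ∈ S^n`. -/
noncomputable def polarPoint (η : Sph n) (θ : ℝ) : Sph (n + 1) :=
  ⟨joinLast (sin θ • (η : EuclideanSpace ℝ (Fin (n + 1)))) (cos θ), by
    rw [mem_sphere_zero_iff_norm, ← sq_eq_sq₀ (norm_nonneg _) zero_le_one, norm_joinLast_sq,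
      norm_smul, norm_eq_of_mem_sphere, mul_one, norm_eq_abs, sq_abs, sin_sq_add_cos_sq, one_pow]⟩

lemma coe_polarPoint (η : Sph n) (θ : ℝ) :
    (polarPoint η θ : EuclideanSpace ℝ (Fin (n + 1 + 1))) =
      joinLast (sin θ • (η : EuclideanSpace ℝ (Fin (n + 1)))) (cos θ) :=
  rfl

@[simp]
lemma lastCoord_polarPoint (η : Sph n) (θ : ℝ) : lastCoord (polarPoint η θ) = cos θ :=
  joinLast_last _ _

@[fun_prop]
lemma measurable_lastCoord : Measurable (lastCoord : Sph n → ℝ) := by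
  unfold lastCoord
  fun_prop

@[fun_prop]
lemma measurable_polarPoint : Measurable fun q : Sph n × ℝ => polarPoint q.1 q.2 :=
  Measurable.subtype_mk (by fun_prop)

lemma norm_polarPoint_sub_sq (ξ η : Sph n) (τ θ : ℝ) :
    ‖(polarPoint ξ τ : EuclideanSpace ℝ (Fin (n + 1 + 1))) - polarPoint η θ‖ ^ 2 =
      2 * (1 - cos τ * cos θ) - 2 * (sin τ * sin θ) *
        inner ℝ (ξ : EuclideanSpace ℝ (Fin (n + 1))) (η : EuclideanSpace ℝ (Fin (n + 1))) := by
  rw [norm_sub_sq_real, norm_eq_of_mem_sphere, norm_eq_of_mem_sphere, coe_polarPoint,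
    coe_polarPoint, inner_joinLast, real_inner_smul_left, real_inner_smul_right]
  ring

lemma exists_polarPoint_eq {x : Sph (n + 1)} (hx : lastCoord x ∈ Ioo (-1) 1) :
    ∃ ξ : Sph n, ∃ τ ∈ Ioo 0 π, polarPoint ξ τ = x := by
  have h_init := joinLast_init (x : EuclideanSpace ℝ (Fin (n + 1 + 1)))
  set v : EuclideanSpace ℝ (Fin (n + 1)) :=
    WithLp.toLp 2 fun i => (x : EuclideanSpace ℝ (Fin (n + 1 + 1))) i.castSucc
  change joinLast v (lastCoord x) = x at h_init
  have h_norm : ‖v‖ = sin (arccos (lastCoord x)) := by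
    have h_sq := norm_joinLast_sq v (lastCoord x)
    rw [h_init, norm_eq_of_mem_sphere] at h_sq
    rw [sin_arccos, ← sqrt_sq (norm_nonneg v)]
    congr 1
    linarith
  have h_arccos : arccos (lastCoord x) ∈ Ioo 0 π :=
    ⟨arccos_pos.2 hx.2, arccos_lt_pi.2 hx.1⟩
  have hv : ‖v‖ ≠ 0 := by
    rw [h_norm]
    exact (sin_pos_of_mem_Ioo h_arccos).ne'
  refine ⟨⟨‖v‖⁻¹ • v, by simp [norm_smul, hv]⟩, _, h_arccos, Subtype.ext ?_⟩
  rw [coe_polarPoint, ← h_norm, smul_inv_smul₀ hv, cos_arccos hx.1.le hx.2.le, h_init]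

instance (n : ℕ) : IsFiniteMeasure (surf n) := by
  unfold surf
  infer_instance

lemma lintegral_eq_lintegral_surf {F : EuclideanSpace ℝ (Fin (n + 1)) → ℝ≥0∞} (hF : Measurable F) :
    ∫⁻ x, F x = ∫⁻ ω : Sph n, (∫⁻ r in Ioi (0 : ℝ), ENNReal.ofReal (r ^ n) *
      F (r • (ω : EuclideanSpace ℝ (Fin (n + 1))))) ∂surf n := by
  simpa using! lintegral_eq_lintegral_toSphere volume hF

lemma lintegral_joinLast_smul {F : EuclideanSpace ℝ (Fin (n + 1 + 1)) → ℝ≥0∞} (hF : Measurable F)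
    (η : Sph n) :
    ∫⁻ ρ in Ioi (0 : ℝ), ∫⁻ z, ENNReal.ofReal (ρ ^ n) *
        F (joinLast (ρ • (η : EuclideanSpace ℝ (Fin (n + 1)))) z) =
      ∫⁻ θ in Ioo 0 π, ∫⁻ r in Ioi 0, ENNReal.ofReal (sin θ ^ n) *
        (ENNReal.ofReal (r ^ (n + 1)) *
          F (r • (polarPoint η θ : EuclideanSpace ℝ (Fin (n + 1 + 1))))) := by
  rw [lintegral_halfPlane_polarCoord (G := fun q => ENNReal.ofReal (q.2 ^ n) *
    F (joinLast (q.2 • (η : EuclideanSpace ℝ (Fin (n + 1)))) q.1)) (by fun_prop)]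
  refine setLIntegral_congr_fun measurableSet_Ioo fun θ hθ =>
    setLIntegral_congr_fun measurableSet_Ioi fun r (hr : 0 < r) => ?_
  have h_sin : 0 < sin θ := sin_pos_of_mem_Ioo hθ
  dsimp only
  rw [coe_polarPoint, smul_joinLast, smul_smul, ← mul_assoc, ← mul_assoc,
    ← ENNReal.ofReal_mul hr.le, ← ENNReal.ofReal_mul (by positivity)]
  congr 2
  ring

lemma lintegral_eq_lintegral_polarPoint {F : EuclideanSpace ℝ (Fin (n + 1 + 1)) → ℝ≥0∞}
    (hF : Measurable F) :
    ∫⁻ x, F x = ∫⁻ θ in Ioo 0 π, ENNReal.ofReal (sin θ ^ n) * ∫⁻ η : Sph n,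
      (∫⁻ r in Ioi (0 : ℝ), ENNReal.ofReal (r ^ (n + 1)) *
        F (r • (polarPoint η θ : EuclideanSpace ℝ (Fin (n + 1 + 1))))) ∂surf n := by
  calc ∫⁻ x, F x = ∫⁻ x : EuclideanSpace ℝ (Fin (n + 1)), ∫⁻ z, F (joinLast x z) := by
        rw [← (measurePreserving_joinLast (n + 1)).lintegral_comp hF, Measure.volume_eq_prod,
          lintegral_prod_symm _ (by fun_prop)]
    _ = ∫⁻ η : Sph n, (∫⁻ ρ in Ioi (0 : ℝ), ∫⁻ z, ENNReal.ofReal (ρ ^ n) *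
          F (joinLast (ρ • (η : EuclideanSpace ℝ (Fin (n + 1)))) z)) ∂surf n := by
        have h_meas : Measurable fun x : EuclideanSpace ℝ (Fin (n + 1)) =>
            ∫⁻ z, F (joinLast x z) :=
          Measurable.lintegral_prod_right' (f := fun q : EuclideanSpace ℝ (Fin (n + 1)) × ℝ =>
            F (joinLast q.1 q.2)) (by fun_prop)
        rw [lintegral_eq_lintegral_surf h_meas]
        refine lintegral_congr fun η => lintegral_congr fun ρ => ?_
        rw [lintegral_const_mul _ (by fun_prop)]
    _ = ∫⁻ η : Sph n, (∫⁻ θ in Ioo 0 π, ∫⁻ r in Ioi 0, ENNReal.ofReal (sin θ ^ n) *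
          (ENNReal.ofReal (r ^ (n + 1)) *
            F (r • (polarPoint η θ : EuclideanSpace ℝ (Fin (n + 1 + 1)))))) ∂surf n :=
        lintegral_congr fun η => lintegral_joinLast_smul hF η
    _ = _ := by
        rw [lintegral_lintegral_swap]
        · refine lintegral_congr fun θ => ?_
          rw [← lintegral_const_mul]
          · refine lintegral_congr fun η => lintegral_const_mul _ (by fun_prop)
          · refine Measurable.lintegral_prod_right' (f := fun q : Sph n × ℝ =>
              ENNReal.ofReal (q.2 ^ (n + 1)) *
                F (q.2 • (polarPoint q.1 θ : EuclideanSpace ℝ (Fin (n + 1 + 1))))) (by fun_prop)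
        · refine Measurable.aemeasurable ?_
          refine Measurable.lintegral_prod_right' (f := fun q : (Sph n × ℝ) × ℝ =>
            ENNReal.ofReal (sin q.1.2 ^ n) * (ENNReal.ofReal (q.2 ^ (n + 1)) *
              F (q.2 • (polarPoint q.1.1 q.1.2 : EuclideanSpace ℝ (Fin (n + 1 + 1))))))
            (by fun_prop)

theorem lintegral_surf {f : Sph (n + 1) → ℝ≥0∞} (hf : Measurable f) :
    ∫⁻ y, f y ∂surf (n + 1) = ∫⁻ θ in Ioo 0 π, ENNReal.ofReal (sin θ ^ n) *
      ∫⁻ η, f (polarPoint η θ) ∂surf n := by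
  obtain ⟨F, hF, hFf⟩ := exists_measurable_radial_extension hf (n + 1)
  simp only [← hFf]
  rw [← lintegral_eq_lintegral_surf hF, lintegral_eq_lintegral_polarPoint hF]

end Sphere

section ZonalIntegrals

open Real

section SphereMap

variable {E : Type*} [NormedAddCommGroup E] [InnerProductSpace ℝ E]

/-- The action of a linear isometry on the unit sphere. -/
def sphereMap (L : E ≃ₗᵢ[ℝ] E) (x : Metric.sphere (0 : E) 1) : Metric.sphere (0 : E) 1 :=
  ⟨L x, by simp⟩

open scoped Pointwise in
lemma measurePreserving_sphereMap [FiniteDimensional ℝ E] [MeasurableSpace E] [BorelSpace E]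
    (L : E ≃ₗᵢ[ℝ] E) :
    MeasurePreserving (sphereMap L) (volume : Measure E).toSphere
      (volume : Measure E).toSphere := by
  have h_meas : Measurable (sphereMap L) :=
    (L.continuous.measurable.comp measurable_subtype_coe).subtype_mk
  refine ⟨h_meas, Measure.ext fun s hs => ?_⟩
  have h_preimage : L ⁻¹' (Ioo (0 : ℝ) 1 • (Subtype.val '' s)) =
      Ioo (0 : ℝ) 1 • (Subtype.val '' (sphereMap L ⁻¹' s)) := by
    ext x
    simp only [mem_preimage, mem_smul, mem_image]
    constructor
    · rintro ⟨r, hr, _, ⟨y, hy, rfl⟩, hx⟩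
      refine ⟨r, hr, L.symm y, ⟨sphereMap L.symm y, ?_, rfl⟩, ?_⟩
      · simpa [sphereMap] using hy
      · rw [← map_smul, hx, L.symm_apply_apply]
    · rintro ⟨r, hr, _, ⟨y, hy, rfl⟩, rfl⟩
      exact ⟨r, hr, L y, ⟨sphereMap L y, hy, rfl⟩, (map_smul L r _).symm⟩
  rw [Measure.map_apply h_meas hs, Measure.toSphere_apply' _ (h_meas hs),
    Measure.toSphere_apply' _ hs, ← h_preimage,
    L.measurePreserving.measure_preimage_emb L.toMeasurableEquiv.measurableEmbedding]

end SphereMap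

variable {n : ℕ}

/-- The pole `(0, …, 0, 1)` of `S^n`. -/
noncomputable def northPole (n : ℕ) : Sph n :=
  ⟨EuclideanSpace.single (Fin.last n) 1, by simp⟩

lemma inner_northPole (y : Sph n) :
    inner ℝ (northPole n : EuclideanSpace ℝ (Fin (n + 1))) (y : EuclideanSpace ℝ (Fin (n + 1))) =
      lastCoord y := by
  simp [northPole, lastCoord, EuclideanSpace.inner_single_left]

lemma lintegral_surf_comp_inner {g : ℝ → ℝ≥0∞} (hg : Measurable g) (ξ : Sph (n + 1)) :
    ∫⁻ η : Sph (n + 1), g (inner ℝ (ξ : EuclideanSpace ℝ (Fin (n + 1 + 1)))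
      (η : EuclideanSpace ℝ (Fin (n + 1 + 1)))) ∂surf (n + 1) =
      surf n univ * ∫⁻ θ in Ioo 0 π, ENNReal.ofReal (sin θ ^ n) * g (cos θ) := by
  set L := (ℝ ∙ ((northPole (n + 1) : EuclideanSpace ℝ (Fin (n + 1 + 1))) - ξ))ᗮ.reflection
  have hL : L (northPole (n + 1) : EuclideanSpace ℝ (Fin (n + 1 + 1))) = ξ :=
    Submodule.reflection_sub (by rw [norm_eq_of_mem_sphere, norm_eq_of_mem_sphere])
  rw [surf, ← (measurePreserving_sphereMap L).lintegral_comp (by fun_prop), ← surf]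
  calc _ = ∫⁻ η : Sph (n + 1), g (lastCoord η) ∂surf (n + 1) := by
        refine lintegral_congr fun η => ?_
        rw [← hL, sphereMap, LinearIsometryEquiv.inner_map_map, inner_northPole]
    _ = _ := by
        rw [lintegral_surf (by fun_prop), ← lintegral_const_mul _ (by fun_prop)]
        refine lintegral_congr fun θ => ?_
        simp only [lastCoord_polarPoint, lintegral_const]
        ring

lemma measurePreserving_neg_surf (n : ℕ) : MeasurePreserving Neg.neg (surf n) (surf n) :=
  measurePreserving_sphereMap (LinearIsometryEquiv.neg ℝ)

@[simp]
lemma lastCoord_neg (x : Sph n) : lastCoord (-x) = -lastCoord x :=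
  rfl

lemma ae_lastCoord_mem_Ioo (n : ℕ) : ∀ᵐ x ∂surf (n + 1), lastCoord x ∈ Ioo (-1) 1 := by
  have h_meas : MeasurableSet {x : Sph (n + 1) | lastCoord x ∈ Ioo (-1) 1} :=
    measurable_lastCoord measurableSet_Ioo
  refine (lintegral_indicator_one h_meas.compl).symm.trans ?_
  rw [lintegral_surf (measurable_one.indicator h_meas.compl),
    setLIntegral_congr_fun (g := 0) measurableSet_Ioo fun θ hθ => ?_, Pi.zero_def, lintegral_zero]
  have h_mem (η : Sph n) : polarPoint η θ ∉ {x : Sph (n + 1) | lastCoord x ∈ Ioo (-1) 1}ᶜ :=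
    not_not.2 (by simpa using mapsTo_cos_Ioo hθ)
  simp only [indicator_of_notMem (h_mem _), lintegral_zero, mul_zero, Pi.zero_apply]

lemma lintegral_surf_rpow_inner_le {A B : ℝ} (hB : |B| < A) (k : ℕ) (ξ : Sph (k + 1)) :
    ∫⁻ η : Sph (k + 1), ENNReal.ofReal ((A - B *
      inner ℝ (ξ : EuclideanSpace ℝ (Fin (k + 1 + 1))) (η : EuclideanSpace ℝ (Fin (k + 1 + 1)))) ^
        (-((k + 2 : ℝ) / 2))) ∂surf (k + 1) ≤
      surf k univ * ENNReal.ofReal ((2 / A) ^ ((k : ℝ) / 2) * (π / √(A ^ 2 - B ^ 2))) := by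
  rw [lintegral_surf_comp_inner (g := fun c => ENNReal.ofReal ((A - B * c) ^ (-((k + 2 : ℝ) / 2))))
    (by fun_prop)]
  gcongr
  exact lintegral_Ioo_sin_pow_mul_rpow_le hB k

lemma lintegral_Ioo_sin_mul_comp_cos (g : ℝ → ℝ≥0∞) :
    ∫⁻ θ in Ioo 0 π, ENNReal.ofReal (sin θ) * g (cos θ) = ∫⁻ s in Ioo (-1) 1, g s := by
  have h_image : cos '' Ioo 0 π = Ioo (-1) 1 := cosPartialHomeomorph.image_source_eq_target
  rw [← h_image, lintegral_image_eq_lintegral_abs_deriv_mul measurableSet_Ioo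
    (fun θ _ => (hasDerivAt_cos θ).hasDerivWithinAt) (injOn_cos.mono Ioo_subset_Icc_self)]
  refine setLIntegral_congr_fun measurableSet_Ioo fun θ hθ => ?_
  rw [abs_neg, abs_of_pos (sin_pos_of_mem_Ioo hθ)]

end ZonalIntegrals

section LeftKernel

open Real

variable {n : ℕ}

/-- The kernel `(x_{n+1} - y_{n+1})_+^α |x - y|^{-n}` of the left-sided integral; with the arguments
exchanged it is the kernel of the right-sided one. -/
noncomputable def leftKernel (α : ℝ) (x y : Sph n) : ℝ :=
  if lastCoord y < lastCoord x then
    (lastCoord x - lastCoord y) ^ α / ‖(x : EuclideanSpace ℝ (Fin (n + 1))) - y‖ ^ n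
  else 0

@[fun_prop]
lemma measurable_leftKernel (α : ℝ) {β : Type*} [MeasurableSpace β] {f g : β → Sph n}
    (hf : Measurable f) (hg : Measurable g) : Measurable fun b => leftKernel α (f b) (g b) :=
  Measurable.ite (measurableSet_lt (by fun_prop) (by fun_prop)) (by fun_prop) measurable_const

lemma leftKernel_neg_neg (α : ℝ) (x y : Sph n) : leftKernel α (-x) (-y) = leftKernel α y x := by
  simp only [leftKernel, lastCoord_neg, neg_lt_neg_iff, coe_neg_sphere, neg_sub_neg]

lemma enorm_leftKernel_of_lt (α : ℝ) {x y : Sph n} (h : lastCoord y < lastCoord x) :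
    ‖leftKernel α x y‖ₑ = ENNReal.ofReal ((lastCoord x - lastCoord y) ^ α) *
      ENNReal.ofReal (‖(x : EuclideanSpace ℝ (Fin (n + 1))) - y‖ ^ n)⁻¹ := by
  rw [leftKernel, if_pos h, enorm_of_nonneg (by positivity), div_eq_mul_inv,
    ENNReal.ofReal_mul (by positivity)]

lemma leftKernel_of_le (α : ℝ) {x y : Sph n} (h : lastCoord x ≤ lastCoord y) :
    leftKernel α x y = 0 :=
  if_neg h.not_gt

lemma two_div_rpow_mul_pi_div_sqrt_le {s t : ℝ} (ht : t ∈ Ioo (-1) 1) (hs : s ∈ Ioo (-1) 1)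
    (hst : s < t) (k : ℕ) {B : ℝ} (hB : (2 * (1 - t * s)) ^ 2 - B ^ 2 = (2 * (t - s)) ^ 2) :
    (2 / (2 * (1 - t * s))) ^ ((k : ℝ) / 2) * (π / √((2 * (1 - t * s)) ^ 2 - B ^ 2)) ≤
      2 ^ ((k : ℝ) / 2) * (π / 2) *
        (((1 + t) * (1 - s)) ^ (-((k : ℝ) / 2)) * (t - s)⁻¹) := by
  have h_pos : 0 < (1 + t) * (1 - s) := mul_pos (by linarith [ht.1]) (by linarith [hs.2])
  have h_sub : 0 < t - s := sub_pos.2 hst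
  have h_le : (1 + t) * (1 - s) ≤ 2 * (1 - t * s) := by
    nlinarith [mul_pos (sub_pos.2 ht.2) (neg_lt_iff_pos_add.1 hs.1)]
  have hA : 0 < 2 * (1 - t * s) := h_pos.trans_le h_le
  rw [hB, sqrt_sq (by positivity)]
  calc _ ≤ (2 / ((1 + t) * (1 - s))) ^ ((k : ℝ) / 2) * (π / (2 * (t - s))) := by
        gcongr
    _ = _ := by
        rw [div_rpow zero_le_two h_pos.le, rpow_neg h_pos.le]
        field_simp

lemma exists_lintegral_inv_norm_polarPoint_sub_pow_le (k : ℕ) : ∃ C : ℝ≥0,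
    ∀ (ξ : Sph (k + 1)) {τ θ : ℝ}, τ ∈ Ioo 0 π → θ ∈ Ioo 0 π → cos θ < cos τ →
      ∫⁻ η : Sph (k + 1), ENNReal.ofReal (‖(polarPoint ξ τ : EuclideanSpace ℝ (Fin (k + 2 + 1))) -
        polarPoint η θ‖ ^ (k + 2))⁻¹ ∂surf (k + 1) ≤
      C * ENNReal.ofReal (((1 + cos τ) * (1 - cos θ)) ^ (-((k : ℝ) / 2)) * (cos τ - cos θ)⁻¹) := by
  refine ⟨(surf k univ).toNNReal * (2 ^ ((k : ℝ) / 2) * (π / 2)).toNNReal,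
    fun ξ τ θ hτ hθ hlt => ?_⟩
  set A := 2 * (1 - cos τ * cos θ)
  set B := 2 * (sin τ * sin θ)
  have h_disc : A ^ 2 - B ^ 2 = (2 * (cos τ - cos θ)) ^ 2 := by
    simp only [A, B, mul_pow, sin_sq]
    ring
  have hA : 0 ≤ A := by
    nlinarith [cos_sq_le_one τ, cos_sq_le_one θ, sq_nonneg (cos τ - cos θ)]
  have hB : |B| < A := by
    refine abs_lt_of_sq_lt_sq (sub_pos.1 ?_) hA
    rw [h_disc]
    exact pow_pos (mul_pos two_pos (sub_pos.2 hlt)) 2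
  calc _ = ∫⁻ η : Sph (k + 1), ENNReal.ofReal ((A - B * inner ℝ
          (ξ : EuclideanSpace ℝ (Fin (k + 1 + 1))) (η : EuclideanSpace ℝ (Fin (k + 1 + 1)))) ^
            (-((k + 2 : ℝ) / 2))) ∂surf (k + 1) := by
        refine lintegral_congr fun η => ?_
        rw [← norm_polarPoint_sub_sq, ← rpow_natCast _ 2, ← rpow_mul (norm_nonneg _),
          ← rpow_natCast, ← rpow_neg (norm_nonneg _)]
        congr 2
        push_cast
        ring
    _ ≤ surf k univ * ENNReal.ofReal ((2 / A) ^ ((k : ℝ) / 2) * (π / √(A ^ 2 - B ^ 2))) :=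
        lintegral_surf_rpow_inner_le hB k ξ
    _ ≤ surf k univ * ENNReal.ofReal (2 ^ ((k : ℝ) / 2) * (π / 2) *
          (((1 + cos τ) * (1 - cos θ)) ^ (-((k : ℝ) / 2)) * (cos τ - cos θ)⁻¹)) := by
        refine mul_le_mul_right (ENNReal.ofReal_le_ofReal ?_) _
        exact two_div_rpow_mul_pi_div_sqrt_le (mapsTo_cos_Ioo hτ) (mapsTo_cos_Ioo hθ) hlt k h_disc
    _ = _ := by
        rw [ENNReal.coe_mul, ENNReal.coe_toNNReal (measure_ne_top _ _), mul_assoc (surf k univ),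
          ENNReal.ofReal_mul (by positivity), ENNReal.ofReal]

lemma sin_pow_succ_mul_rpow_eq {t θ : ℝ} (ht : -1 < t) (hθ : θ ∈ Ioo 0 π) (k : ℕ) :
    sin θ ^ (k + 1) * ((1 + t) * (1 - cos θ)) ^ (-((k : ℝ) / 2)) =
      sin θ * ((1 + t) ^ (-((k : ℝ) / 2)) * (1 + cos θ) ^ ((k : ℝ) / 2)) := by
  obtain ⟨h_left, h_right⟩ := mapsTo_cos_Ioo hθ
  have h_sin : 0 < sin θ := sin_pos_of_mem_Ioo hθ
  have h_add : 0 < 1 + cos θ := by linarith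
  have h_sub : 0 < 1 - cos θ := by linarith
  have h_pow : sin θ ^ k = (1 - cos θ) ^ ((k : ℝ) / 2) * (1 + cos θ) ^ ((k : ℝ) / 2) := by
    rw [← mul_rpow h_sub.le h_add.le, show (1 - cos θ) * (1 + cos θ) = sin θ ^ 2 by
      rw [sin_sq]; ring, ← rpow_natCast _ 2, ← rpow_mul h_sin.le, ← rpow_natCast]
    congr 1
    push_cast
    ring
  rw [pow_succ, h_pow, mul_rpow (by linarith) h_sub.le, rpow_neg h_sub.le]
  field_simp

lemma exists_lintegral_leftKernel_polarPoint_le (k : ℕ) : ∃ C : ℝ≥0, ∀ (α : ℝ) (ξ : Sph (k + 1))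
    {τ θ : ℝ}, τ ∈ Ioo 0 π → θ ∈ Ioo 0 π → cos θ < cos τ →
      ENNReal.ofReal (sin θ ^ (k + 1)) *
        ∫⁻ η, ‖leftKernel α (polarPoint ξ τ) (polarPoint η θ)‖ₑ ∂surf (k + 1) ≤
      ENNReal.ofReal (sin θ) * (C * ENNReal.ofReal ((1 + cos τ) ^ (-((k : ℝ) / 2)) *
        ((cos τ - cos θ) ^ (α - 1) * (1 + cos θ) ^ ((k : ℝ) / 2)))) := by
  obtain ⟨C, hC⟩ := exists_lintegral_inv_norm_polarPoint_sub_pow_le k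
  refine ⟨C, fun α ξ τ θ hτ hθ hlt => ?_⟩
  have h_sin : 0 < sin θ := sin_pos_of_mem_Ioo hθ
  have h_sub : 0 < cos τ - cos θ := sub_pos.2 hlt
  calc _ = ENNReal.ofReal (sin θ ^ (k + 1)) * (ENNReal.ofReal ((cos τ - cos θ) ^ α) *
        ∫⁻ η : Sph (k + 1), ENNReal.ofReal (‖(polarPoint ξ τ : EuclideanSpace ℝ (Fin (k + 2 + 1))) -
          polarPoint η θ‖ ^ (k + 2))⁻¹ ∂surf (k + 1)) := by
        rw [← lintegral_const_mul (ENNReal.ofReal ((cos τ - cos θ) ^ α)) (by fun_prop)]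
        congr 1
        refine lintegral_congr fun η => ?_
        rw [enorm_leftKernel_of_lt α (by simpa using hlt), lastCoord_polarPoint,
          lastCoord_polarPoint]
    _ ≤ ENNReal.ofReal (sin θ ^ (k + 1)) * (ENNReal.ofReal ((cos τ - cos θ) ^ α) *
          (C * ENNReal.ofReal (((1 + cos τ) * (1 - cos θ)) ^ (-((k : ℝ) / 2)) *
            (cos τ - cos θ)⁻¹))) := by
        gcongr
        exact hC ξ hτ hθ hlt
    _ = _ := by
        rw [mul_left_comm _ (C : ℝ≥0∞), mul_left_comm _ (C : ℝ≥0∞), mul_left_comm _ (C : ℝ≥0∞),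
          ← ENNReal.ofReal_mul (by positivity), ← ENNReal.ofReal_mul (by positivity),
          ← ENNReal.ofReal_mul (by positivity)]
        congr 2
        rw [rpow_sub_one h_sub.ne']
        linear_combination (cos τ - cos θ) ^ α * (cos τ - cos θ)⁻¹ *
          sin_pow_succ_mul_rpow_eq (mapsTo_cos_Ioo hτ).1 hθ k

theorem exists_lintegral_leftKernel_mul_le (k : ℕ) : ∃ C : ℝ≥0, ∀ (α : ℝ) {g : ℝ → ℝ≥0∞},
    Measurable g → ∀ x : Sph (k + 2), lastCoord x ∈ Ioo (-1) 1 →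
    ∫⁻ y, ‖leftKernel α x y‖ₑ * g (lastCoord y) ∂surf (k + 2) ≤
      C * ∫⁻ s in Ioo (-1) (lastCoord x), ENNReal.ofReal ((1 + lastCoord x) ^ (-((k : ℝ) / 2)) *
        ((lastCoord x - s) ^ (α - 1) * (1 + s) ^ ((k : ℝ) / 2))) * g s := by
  obtain ⟨C, hC⟩ := exists_lintegral_leftKernel_polarPoint_le k
  refine ⟨C, fun α g hg x hx => ?_⟩
  obtain ⟨ξ, τ, hτ, rfl⟩ := exists_polarPoint_eq hx
  rw [lastCoord_polarPoint] at hx ⊢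
  set G : ℝ → ℝ≥0∞ := fun s => ENNReal.ofReal ((1 + cos τ) ^ (-((k : ℝ) / 2)) *
    ((cos τ - s) ^ (α - 1) * (1 + s) ^ ((k : ℝ) / 2)))
  have h_slice (θ : ℝ) (hθ : θ ∈ Ioo 0 π) : ENNReal.ofReal (sin θ ^ (k + 1)) *
      ∫⁻ η, ‖leftKernel α (polarPoint ξ τ) (polarPoint η θ)‖ₑ * g (lastCoord (polarPoint η θ))
        ∂surf (k + 1) ≤
      ENNReal.ofReal (sin θ) * (Iio (cos τ)).indicator (fun s => C * (G s * g s)) (cos θ) := by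
    rcases lt_or_ge (cos θ) (cos τ) with h | h
    · simp only [lastCoord_polarPoint, indicator_of_mem (mem_Iio.2 h)]
      rw [lintegral_mul_const _ (by fun_prop), ← mul_assoc, ← mul_assoc (C : ℝ≥0∞), ← mul_assoc]
      exact mul_le_mul_left (hC α ξ hτ hθ h) _
    · have h_zero (η : Sph (k + 1)) : leftKernel α (polarPoint ξ τ) (polarPoint η θ) = 0 :=
        leftKernel_of_le α (by simpa using h)
      simp only [h_zero, enorm_zero, zero_mul, lintegral_zero, mul_zero, zero_le]
  calc _ ≤ ∫⁻ θ in Ioo 0 π, ENNReal.ofReal (sin θ) *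
          (Iio (cos τ)).indicator (fun s => C * (G s * g s)) (cos θ) := by
        rw [lintegral_surf (by fun_prop)]
        exact setLIntegral_mono' measurableSet_Ioo h_slice
    _ = ∫⁻ s in Ioo (-1) (cos τ), C * (G s * g s) := by
        rw [lintegral_Ioo_sin_mul_comp_cos, lintegral_indicator measurableSet_Iio,
          Measure.restrict_restrict measurableSet_Iio, inter_comm, Ioo_inter_Iio,
          min_eq_right hx.2.le]
    _ = C * ∫⁻ s in Ioo (-1) (cos τ), G s * g s := lintegral_const_mul _ (by fun_prop)

end LeftKernel

section WeightEstimates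

variable {n : ℕ} {x : Sph n}

lemma weight_pos (hx : lastCoord x ∈ Ioo (-1) 1) (a b : ℝ) : 0 < weight n a b x :=
  mul_pos (Real.rpow_pos_of_pos (neg_lt_iff_pos_add'.1 hx.1) a)
    (Real.rpow_pos_of_pos (sub_pos.2 hx.2) b)

lemma weight_zero_zero (x : Sph n) : weight n 0 0 x = 1 := by
  simp only [weight, Real.rpow_zero, mul_one]

lemma weight_add (hx : lastCoord x ∈ Ioo (-1) 1) (a b c d : ℝ) :
    weight n (a + c) (b + d) x = weight n a b x * weight n c d x := by
  simp only [weight, Real.rpow_add (neg_lt_iff_pos_add'.1 hx.1), Real.rpow_add (sub_pos.2 hx.2)]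
  ring

lemma weight_rpow (hx : lastCoord x ∈ Ioo (-1) 1) (a b r : ℝ) :
    weight n a b x ^ r = weight n (a * r) (b * r) x := by
  have h_add : 0 ≤ 1 + lastCoord x := (neg_lt_iff_pos_add'.1 hx.1).le
  have h_sub : 0 ≤ 1 - lastCoord x := (sub_pos.2 hx.2).le
  rw [weight, weight, Real.mul_rpow (by positivity) (by positivity), Real.rpow_mul h_add,
    Real.rpow_mul h_sub]

lemma enorm_weight_rpow (hx : lastCoord x ∈ Ioo (-1) 1) (a b : ℝ) {r : ℝ} (hr : 0 ≤ r) :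
    ‖weight n a b x‖ₑ ^ r = ‖weight n (a * r) (b * r) x‖ₑ := by
  rw [← weight_rpow hx, Real.enorm_rpow_of_nonneg (weight_pos hx a b).le hr]

lemma weight_le (hx : lastCoord x ∈ Ioo (-1) 1) {a b : ℝ} (ha : 0 ≤ a) (hb : 0 ≤ b) :
    weight n a b x ≤ 2 ^ a * 2 ^ b := by
  have h_add : 0 < 1 + lastCoord x := neg_lt_iff_pos_add'.1 hx.1
  have h_sub : 0 < 1 - lastCoord x := sub_pos.2 hx.2
  unfold weight
  gcongr <;> linarith

lemma weight_neg (a b : ℝ) (x : Sph n) : weight n a b (-x) = weight n b a x := by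
  rw [weight, weight, lastCoord_neg, sub_neg_eq_add, ← sub_eq_add_neg, mul_comm]

@[fun_prop]
lemma measurable_weight (a b : ℝ) : Measurable (weight n a b) := by
  unfold weight
  fun_prop

/-- The integral operator with kernel `|κ|` maps the weight with exponents `a`, `b` to a function
dominated by the weight with exponents `a + α`, `b + α`. Estimates of this form, for a kernel and
its transpose, are what Schur's test requires when the test functions are weights. -/
def RaisesWeight (κ : Sph n → Sph n → ℝ) (α a b : ℝ) : Prop :=
  ∃ C : ℝ≥0, ∀ᵐ x ∂surf n,
    ∫⁻ y, ‖κ x y‖ₑ * ‖weight n a b y‖ₑ ∂surf n ≤ C * ‖weight n (a + α) (b + α) x‖ₑ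

lemma RaisesWeight.comp_neg {κ : Sph n → Sph n → ℝ} (hκ : Measurable (Function.uncurry κ))
    {α a b : ℝ} (h : RaisesWeight κ α a b) : RaisesWeight (fun x y => κ (-x) (-y)) α b a := by
  obtain ⟨C, hC⟩ := h
  have h_neg := measurePreserving_neg_surf n
  refine ⟨C, ?_⟩
  filter_upwards [h_neg.quasiMeasurePreserving.ae hC] with x hx
  have hκx : Measurable (κ (-x)) := hκ.comp measurable_prodMk_left
  rw [weight_neg, ← h_neg.lintegral_comp (by fun_prop)] at hx
  simpa only [weight_neg] using hx

lemma exists_lintegral_Ioo_neg_one_weight_le {α a b e : ℝ} (hα : 0 < α) (ha : -1 < a + e)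
    (hb : b < -α) : ∃ C : ℝ≥0, ∀ t ∈ Ioo (-1 : ℝ) 1,
      ∫⁻ s in Ioo (-1) t, ENNReal.ofReal ((1 + t) ^ (-e) * ((t - s) ^ (α - 1) * (1 + s) ^ e)) *
        ‖(1 + s) ^ a * (1 - s) ^ b‖ₑ ≤ C * ‖(1 + t) ^ (a + α) * (1 - t) ^ (b + α)‖ₑ := by
  obtain ⟨C, hC⟩ := exists_lintegral_riemannLiouville_le (c := a + e + 1) (d := -b) hα
    (by linarith) (by linarith)
  refine ⟨C * (2 ^ (-α) : ℝ).toNNReal, fun t ht => ?_⟩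
  have h_add : 0 < 1 + t := neg_lt_iff_pos_add'.1 ht.1
  have h_sub : 0 < 1 - t := sub_pos.2 ht.2
  calc _ = ENNReal.ofReal ((1 + t) ^ (-e)) * ∫⁻ s in Ioo (-1) t, ENNReal.ofReal
          ((t - s) ^ (α - 1) * (s - (-1)) ^ (a + e + 1 - 1) * (1 - s) ^ (-(-b))) := by
        rw [← lintegral_const_mul _ (by fun_prop)]
        refine setLIntegral_congr_fun measurableSet_Ioo fun s hs => ?_
        have hs_add : 0 < 1 + s := neg_lt_iff_pos_add'.1 hs.1
        have hs_sub : 0 < 1 - s := by linarith [hs.2, ht.2]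
        have hs_mid : 0 < t - s := sub_pos.2 hs.2
        simp only [add_sub_cancel_right, sub_neg_eq_add, add_comm s, neg_neg]
        rw [Real.enorm_of_nonneg (by positivity), ← ENNReal.ofReal_mul (by positivity),
          ← ENNReal.ofReal_mul (by positivity), Real.rpow_add hs_add]
        congr 1
        ring
    _ ≤ ENNReal.ofReal ((1 + t) ^ (-e)) * (C * ENNReal.ofReal
          ((t - (-1)) ^ (α + (a + e + 1) - 1) * (1 - t) ^ (α - -b) * (1 - (-1)) ^ (-α))) := by
        grw [hC (-1) t 1 ht.1 ht.2]
    _ = _ := by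
        rw [Real.enorm_of_nonneg (by positivity), ENNReal.coe_mul, mul_left_comm,
          mul_assoc (C : ℝ≥0∞), ← ENNReal.ofReal, ← ENNReal.ofReal_mul (by positivity),
          ← ENNReal.ofReal_mul (by positivity),
          show a + α = -e + (α + (a + e + 1) - 1) by ring, Real.rpow_add h_add, sub_neg_eq_add,
          sub_neg_eq_add, sub_neg_eq_add, add_comm b, add_comm t, one_add_one_eq_two]
        congr 2
        ring

theorem raisesWeight_leftKernel (hn : 2 ≤ n) {α a b : ℝ} (hα : 0 < α) (ha : -((n : ℝ) / 2) < a)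
    (hb : b < -α) : RaisesWeight (leftKernel (n := n) α) α a b := by
  obtain ⟨k, rfl⟩ := Nat.exists_eq_add_of_le' hn
  push_cast at ha
  obtain ⟨C₁, hC₁⟩ := exists_lintegral_leftKernel_mul_le k
  obtain ⟨C₂, hC₂⟩ := exists_lintegral_Ioo_neg_one_weight_le (e := (k : ℝ) / 2) (a := a) hα
    (by linarith) hb
  refine ⟨C₁ * C₂, ?_⟩
  filter_upwards [ae_lastCoord_mem_Ioo (k + 1)] with x hx
  grw [ENNReal.coe_mul, mul_assoc, weight, ← hC₂ _ hx]
  exact hC₁ α (g := fun s => ‖(1 + s) ^ a * (1 - s) ^ b‖ₑ) (by fun_prop) x hx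

theorem raisesWeight_leftKernel_flip (hn : 2 ≤ n) {α a b : ℝ} (hα : 0 < α) (ha : a < -α)
    (hb : -((n : ℝ) / 2) < b) : RaisesWeight (fun x y : Sph n => leftKernel α y x) α a b := by
  simpa only [leftKernel_neg_neg] using
    (raisesWeight_leftKernel hn hα hb ha).comp_neg
      (measurable_leftKernel α measurable_fst measurable_snd)

end WeightEstimates

section WeightedBounds

variable {n : ℕ} {p p' : ℝ≥0∞} {κ : Sph (n + 1) → Sph (n + 1) → ℝ} {α μ ν : ℝ}

/-- The kernel obtained from `κ` by conjugation with weights: boundedness of the integral operator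
with kernel `κ` from the exponents `μ`, `ν` to `μ - α`, `ν - α` amounts to boundedness of this one
in the unweighted space. -/
noncomputable def weightedKernel {n : ℕ} (κ : Sph n → Sph n → ℝ) (α μ ν : ℝ) (x y : Sph n) : ℝ :=
  weight n (μ - α) (ν - α) x * (κ x y * weight n (-μ) (-ν) y)

lemma weightedKernel_flip {n : ℕ} (κ : Sph n → Sph n → ℝ) (α μ ν : ℝ) (x y : Sph n) :
    weightedKernel (fun x y => κ y x) α (α - μ) (α - ν) y x = weightedKernel κ α μ ν x y := by
  simp only [weightedKernel, sub_sub_cancel_left, neg_sub]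
  ring

lemma measurable_weightedKernel {n : ℕ} {κ : Sph n → Sph n → ℝ}
    (hκ : Measurable (Function.uncurry κ)) (α μ ν : ℝ) :
    Measurable (Function.uncurry (weightedKernel κ α μ ν)) :=
  ((measurable_weight _ _).comp measurable_fst).mul
    (hκ.mul ((measurable_weight _ _).comp measurable_snd))

lemma weightedKernel_smul_weight_mul {n : ℕ} (κ : Sph n → Sph n → ℝ) (α μ ν : ℝ) (x : Sph n)
    {y : Sph n} (hy : lastCoord y ∈ Ioo (-1) 1) (z : ℂ) :
    weightedKernel κ α μ ν x y • ((weight n μ ν y : ℂ) * z) =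
      weight n (μ - α) (ν - α) x • (κ x y • z) := by
  have h_inv : weight n (-μ) (-ν) y * weight n μ ν y = 1 := by
    rw [← weight_add hy, neg_add_cancel, neg_add_cancel, weight_zero_zero]
  rw [← Complex.real_smul, weightedKernel, smul_smul, mul_assoc, mul_assoc, h_inv, mul_one,
    smul_smul]

lemma RaisesWeight.exists_lintegral_weightedKernel_le {a b r : ℝ} (hr : 0 ≤ r)
    (hκ : RaisesWeight κ α (a * r - μ) (b * r - ν)) :
    ∃ C : ℝ≥0, ∀ᵐ x ∂surf (n + 1),
      ∫⁻ y, ‖weightedKernel κ α μ ν x y‖ₑ * ‖weight (n + 1) a b y‖ₑ ^ r ∂surf (n + 1) ≤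
        C * ‖weight (n + 1) a b x‖ₑ ^ r := by
  obtain ⟨C, hC⟩ := hκ
  refine ⟨C, ?_⟩
  filter_upwards [hC, ae_lastCoord_mem_Ioo n] with x hx hx_mem
  calc ∫⁻ y, ‖weightedKernel κ α μ ν x y‖ₑ * ‖weight (n + 1) a b y‖ₑ ^ r ∂surf (n + 1)
      = ‖weight (n + 1) (μ - α) (ν - α) x‖ₑ *
          ∫⁻ y, ‖κ x y‖ₑ * ‖weight (n + 1) (a * r - μ) (b * r - ν) y‖ₑ ∂surf (n + 1) := by
        rw [← lintegral_const_mul' _ _ enorm_ne_top]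
        refine lintegral_congr_ae ?_
        filter_upwards [ae_lastCoord_mem_Ioo n] with y hy
        rw [enorm_weight_rpow hy _ _ hr, sub_eq_add_neg (a * r), sub_eq_add_neg (b * r),
          weight_add hy, weightedKernel, enorm_mul, enorm_mul, enorm_mul]
        ring
    _ ≤ ‖weight (n + 1) (μ - α) (ν - α) x‖ₑ *
          (C * ‖weight (n + 1) (a * r - μ + α) (b * r - ν + α) x‖ₑ) := by grw [hx]
    _ = C * ‖weight (n + 1) a b x‖ₑ ^ r := by
        rw [enorm_weight_rpow hx_mem _ _ hr, mul_left_comm, ← enorm_mul, ← weight_add hx_mem,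
          show μ - α + (a * r - μ + α) = a * r by ring,
          show ν - α + (b * r - ν + α) = b * r by ring]

lemma exists_isSchurKernel_weightedKernel (hκ : Measurable (Function.uncurry κ)) {a b : ℝ}
    (h_right : RaisesWeight κ α (a * (1 / p).toReal - μ) (b * (1 / p).toReal - ν))
    (h_left : RaisesWeight (fun x y => κ y x) α
      (a * (1 / p').toReal - (α - μ)) (b * (1 / p').toReal - (α - ν))) :
    ∃ C : ℝ≥0, IsSchurKernel (surf (n + 1)) (surf (n + 1)) p p'
      (fun x y => ‖weightedKernel κ α μ ν x y‖ₑ) (fun x => ‖weight (n + 1) a b x‖ₑ)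
      (fun y => ‖weight (n + 1) a b y‖ₑ) C := by
  obtain ⟨C₁, hC₁⟩ := h_right.exists_lintegral_weightedKernel_le ENNReal.toReal_nonneg
  obtain ⟨C₂, hC₂⟩ := h_left.exists_lintegral_weightedKernel_le ENNReal.toReal_nonneg
  refine ⟨max C₁ C₂, (measurable_weightedKernel hκ α μ ν).enorm, by fun_prop, by fun_prop, ?_, ?_,
    ?_⟩
  · filter_upwards [ae_lastCoord_mem_Ioo n] with y hy
    exact ⟨enorm_ne_zero.2 (weight_pos hy a b).ne', enorm_ne_top⟩
  · filter_upwards [hC₁] with x hx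
    exact hx.trans (by gcongr; exact le_max_left C₁ C₂)
  · filter_upwards [hC₂] with y hy
    simp only [weightedKernel_flip] at hy
    exact hy.trans (by gcongr; exact le_max_right C₁ C₂)

theorem IsSchurKernel.isBoundedOp [p.HolderConjugate p'] {V W : Sph (n + 1) → ℝ≥0∞} {C : ℝ≥0}
    (hS : IsSchurKernel (surf (n + 1)) (surf (n + 1)) p p'
      (fun x y => ‖weightedKernel κ α μ ν x y‖ₑ) V W C)
    (hκ : Measurable (Function.uncurry κ)) {c : ℂ}
    {T : (Sph (n + 1) → ℂ) → Sph (n + 1) → ℂ} {E : (Sph (n + 1) → ℂ) → Sph (n + 1) → Prop}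
    (hT : ∀ φ x, T φ x = c * ∫ y, κ x y • φ y ∂surf (n + 1))
    (hE : ∀ φ x, E φ x ↔ Integrable (fun y => κ x y • φ y) (surf (n + 1))) :
    IsBoundedOp T E p (weight (n + 1) μ ν) (weight (n + 1) (μ - α) (ν - α)) := by
  refine ⟨‖c‖₊ * C, fun φ hφ => ?_⟩
  set f : Sph (n + 1) → ℂ := fun y => weight (n + 1) μ ν y * φ y
  have h_kernel (x : Sph (n + 1)) : (fun y => weightedKernel κ α μ ν x y • f y) =ᵐ[surf (n + 1)]
      fun y => weight (n + 1) (μ - α) (ν - α) x • (κ x y • φ y) := by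
    filter_upwards [ae_lastCoord_mem_Ioo n] with y hy
    exact weightedKernel_smul_weight_mul κ α μ ν x hy (φ y)
  have h_weight_mul_T : (fun x => (weight (n + 1) (μ - α) (ν - α) x : ℂ) * T φ x) =
      c • fun x => ∫ y, weightedKernel κ α μ ν x y • f y ∂surf (n + 1) := by
    funext x
    rw [Pi.smul_apply, integral_congr_ae (h_kernel x), integral_smul, hT, smul_eq_mul,
      Complex.real_smul, mul_left_comm]
  have hκ_meas := measurable_weightedKernel hκ α μ ν
  refine ⟨?_, ?_, ?_⟩
  · filter_upwards [hS.ae_integrable_smul hκ_meas hφ, ae_lastCoord_mem_Ioo n] with x hx hx_mem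
    rw [hE, ← integrable_smul_iff (weight_pos hx_mem (μ - α) (ν - α)).ne']
    exact hx.congr (h_kernel x)
  · rw [MemWLp, h_weight_mul_T]
    exact (hS.memLp_integral_smul hκ_meas hφ).const_smul c
  · rw [wNorm, h_weight_mul_T, eLpNorm_const_smul, ENNReal.coe_mul, mul_assoc, wNorm]
    exact mul_le_mul_right (hS.eLpNorm_integral_smul_le hφ.1) ‖c‖ₑ

lemma IsBoundedOp.weight_mono {T : (Sph (n + 1) → ℂ) → Sph (n + 1) → ℂ}
    {E : (Sph (n + 1) → ℂ) → Sph (n + 1) → Prop} {v : Sph (n + 1) → ℝ} {μ' ν' : ℝ}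
    (h : IsBoundedOp T E p (weight (n + 1) μ' ν') v) (hμ : μ ≤ μ') (hν : ν ≤ ν') :
    IsBoundedOp T E p (weight (n + 1) μ ν) v := by
  obtain ⟨C, hC⟩ := h
  set D : ℝ≥0 := (2 ^ (μ' - μ) * 2 ^ (ν' - ν) : ℝ).toNNReal
  refine ⟨C * D, fun φ hφ => ?_⟩
  have h_eq : (fun x => (weight (n + 1) (μ' - μ) (ν' - ν) x : ℂ) * (weight (n + 1) μ ν x * φ x))
      =ᵐ[surf (n + 1)] fun x => (weight (n + 1) μ' ν' x : ℂ) * φ x := by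
    filter_upwards [ae_lastCoord_mem_Ioo n] with x hx
    rw [← mul_assoc, ← Complex.ofReal_mul, ← weight_add hx, sub_add_cancel, sub_add_cancel]
  have h_le : ∀ᵐ x ∂surf (n + 1), ‖(weight (n + 1) μ' ν' x : ℂ) * φ x‖ₑ ≤
      D * ‖(weight (n + 1) μ ν x : ℂ) * φ x‖ₑ := by
    filter_upwards [ae_lastCoord_mem_Ioo n, h_eq] with x hx hx_eq
    rw [← hx_eq, enorm_mul, ← ofReal_norm, Complex.norm_real, ofReal_norm,
      Real.enorm_of_nonneg (weight_pos hx _ _).le]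
    gcongr
    exact ENNReal.ofReal_le_ofReal (weight_le hx (sub_nonneg.2 hμ) (sub_nonneg.2 hν))
  have h_meas : AEStronglyMeasurable (fun x => (weight (n + 1) μ' ν' x : ℂ) * φ x)
      (surf (n + 1)) :=
    (AEStronglyMeasurable.mul (by fun_prop) hφ.1).congr h_eq
  obtain ⟨h_exists, h_mem, h_norm⟩ := hC φ (MemLp.of_enorm_le_mul hφ h_meas h_le)
  refine ⟨h_exists, h_mem, h_norm.trans ?_⟩
  rw [ENNReal.coe_mul, mul_assoc]
  exact mul_le_mul_right (eLpNorm_le_mul_eLpNorm_of_ae_le_mul' h_le p) _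

end WeightedBounds

section FractionalIntegrals

variable {n : ℕ} {p p' : ℝ≥0∞} {α μ ν : ℝ}

lemma measurableSet_segment (n : ℕ) (a b : ℝ) : MeasurableSet (segment n a b) :=
  measurable_lastCoord measurableSet_Ioo

lemma indicator_leftIntegrand_ae_eq (α : ℝ) (φ : Sph (n + 1) → ℂ) (x : Sph (n + 1)) :
    (segment (n + 1) (-1) (lastCoord x)).indicator (leftIntegrand α φ x) =ᵐ[surf (n + 1)]
      fun y => leftKernel α x y • φ y := by
  filter_upwards [ae_lastCoord_mem_Ioo n] with y hy
  by_cases h : lastCoord y < lastCoord x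
  · have hy_mem : y ∈ segment (n + 1) (-1) (lastCoord x) := ⟨hy.1, h⟩
    rw [indicator_of_mem hy_mem, leftKernel, if_pos h, Complex.real_smul, leftIntegrand]
  · rw [indicator_of_notMem fun hy_mem => h hy_mem.2, leftKernel, if_neg h, zero_smul]

lemma indicator_rightIntegrand_ae_eq (α : ℝ) (φ : Sph (n + 1) → ℂ) (x : Sph (n + 1)) :
    (segment (n + 1) (lastCoord x) 1).indicator (rightIntegrand α φ x) =ᵐ[surf (n + 1)]
      fun y => leftKernel α y x • φ y := by
  filter_upwards [ae_lastCoord_mem_Ioo n] with y hy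
  by_cases h : lastCoord x < lastCoord y
  · have hy_mem : y ∈ segment (n + 1) (lastCoord x) 1 := ⟨h, hy.2⟩
    rw [indicator_of_mem hy_mem, leftKernel, if_pos h, Complex.real_smul, rightIntegrand,
      norm_sub_rev]
  · rw [indicator_of_notMem fun hy_mem => h hy_mem.1, leftKernel, if_neg h, zero_smul]

lemma SPlus_eq_integral (α : ℝ) (φ : Sph (n + 1) → ℂ) (x : Sph (n + 1)) :
    SPlus α φ x = ((2 / (Real.Gamma α * sphereArea (n + 1)) : ℝ) : ℂ) *
      ∫ y, leftKernel α x y • φ y ∂surf (n + 1) := by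
  rw [SPlus, leftFrac, ← integral_indicator (measurableSet_segment _ _ _),
    integral_congr_ae (indicator_leftIntegrand_ae_eq α φ x)]

lemma SMinus_eq_integral (α : ℝ) (φ : Sph (n + 1) → ℂ) (x : Sph (n + 1)) :
    SMinus α φ x = ((2 / (Real.Gamma α * sphereArea (n + 1)) : ℝ) : ℂ) *
      ∫ y, leftKernel α y x • φ y ∂surf (n + 1) := by
  rw [SMinus, rightFrac, ← integral_indicator (measurableSet_segment _ _ _),
    integral_congr_ae (indicator_rightIntegrand_ae_eq α φ x)]

lemma leftFracExists_iff_integrable (α : ℝ) (φ : Sph (n + 1) → ℂ) (x : Sph (n + 1)) :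
    LeftFracExists α (-1) φ x ↔ Integrable (fun y => leftKernel α x y • φ y) (surf (n + 1)) := by
  rw [LeftFracExists, ← integrable_indicator_iff (measurableSet_segment _ _ _),
    integrable_congr (indicator_leftIntegrand_ae_eq α φ x)]

lemma rightFracExists_iff_integrable (α : ℝ) (φ : Sph (n + 1) → ℂ) (x : Sph (n + 1)) :
    RightFracExists α 1 φ x ↔ Integrable (fun y => leftKernel α y x • φ y) (surf (n + 1)) := by
  rw [RightFracExists, ← integrable_indicator_iff (measurableSet_segment _ _ _),
    integrable_congr (indicator_rightIntegrand_ae_eq α φ x)]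

theorem isBoundedOp_SPlus [p.HolderConjugate p'] (hn : 2 ≤ n) (hα : 0 < α)
    (hμ : μ < n / 2 * (1 / p').toReal) (hν : -(n / 2 * (1 / p).toReal) < ν - α) :
    IsBoundedOp (SPlus α) (LeftFracExists α (-1)) p (weight n μ ν)
      (weight n (μ - α) (ν - α)) := by
  obtain ⟨n, rfl⟩ := Nat.exists_eq_add_of_le' (one_le_two.trans hn)
  obtain ⟨h, h_def⟩ : ∃ h : ℝ, h = (n + 1 : ℕ) / 2 := ⟨_, rfl⟩
  rw [← h_def] at hμ hν
  have h_sum : h * (1 / p).toReal + h * (1 / p').toReal = h := by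
    rw [← mul_add, toReal_one_div_add_toReal_one_div, mul_one]
  have hκ : Measurable (Function.uncurry (leftKernel (n := n + 1) α)) :=
    measurable_leftKernel α measurable_fst measurable_snd
  obtain ⟨C, hC⟩ := exists_isSchurKernel_weightedKernel (p := p) (p' := p') hκ (a := -h) (b := -h)
    (raisesWeight_leftKernel (a := -h * (1 / p).toReal - μ) (b := -h * (1 / p).toReal - ν) hn hα
      (by linarith) (by linarith))
    (raisesWeight_leftKernel_flip hn hα (by linarith) (by linarith))
  exact hC.isBoundedOp hκ (SPlus_eq_integral α) (leftFracExists_iff_integrable α)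

theorem isBoundedOp_SMinus [p.HolderConjugate p'] (hn : 2 ≤ n) (hα : 0 < α)
    (hμ : -(n / 2 * (1 / p).toReal) < μ - α) (hν : ν < n / 2 * (1 / p').toReal) :
    IsBoundedOp (SMinus α) (RightFracExists α 1) p (weight n μ ν)
      (weight n (μ - α) (ν - α)) := by
  obtain ⟨n, rfl⟩ := Nat.exists_eq_add_of_le' (one_le_two.trans hn)
  obtain ⟨h, h_def⟩ : ∃ h : ℝ, h = (n + 1 : ℕ) / 2 := ⟨_, rfl⟩
  rw [← h_def] at hμ hν
  have h_sum : h * (1 / p).toReal + h * (1 / p').toReal = h := by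
    rw [← mul_add, toReal_one_div_add_toReal_one_div, mul_one]
  have hκ : Measurable (Function.uncurry fun x y : Sph (n + 1) => leftKernel α y x) :=
    measurable_leftKernel α measurable_snd measurable_fst
  obtain ⟨C, hC⟩ := exists_isSchurKernel_weightedKernel (p := p) (p' := p') hκ (a := -h) (b := -h)
    (raisesWeight_leftKernel_flip (a := -h * (1 / p).toReal - μ) (b := -h * (1 / p).toReal - ν) hn
      hα (by linarith) (by linarith))
    (raisesWeight_leftKernel hn hα (by linarith) (by linarith))
  exact hC.isBoundedOp hκ (SMinus_eq_integral α) (rightFracExists_iff_integrable α)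

lemma neg_lt_shiftedExp (n : ℕ) (p : ℝ≥0∞) (α c : ℝ) {ε : ℝ} (hε : 0 < ε) :
    -(n / 2 * (1 / p).toReal) < shiftedExp n p α c ε := by
  rw [shiftedExp]
  split_ifs with h
  · exact h
  · linarith

lemma le_shiftedExp_add (n : ℕ) (p : ℝ≥0∞) (α c : ℝ) {ε : ℝ} (hε : 0 < ε) :
    c ≤ shiftedExp n p α c ε + α := by
  rw [shiftedExp]
  split_ifs <;> linarith

end FractionalIntegrals

end SphericalFrac

theorem mainTheorem5 (n : ℕ) (hn : 2 ≤ n) (p p' : ENNReal) (hp : ENNReal.HolderConjugate p p')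
    (α μ ν ε : ℝ) (hα : 0 < α) (hε : 0 < ε) :
    (μ < (n : ℝ) / 2 * (1 / p').toReal →
      SphericalFrac.IsBoundedOp (SphericalFrac.SPlus α) (SphericalFrac.LeftFracExists α (-1)) p
        (SphericalFrac.weight n μ ν)
        (SphericalFrac.weight n (μ - α) (SphericalFrac.shiftedExp n p α ν ε))) ∧
    (ν < (n : ℝ) / 2 * (1 / p').toReal →
      SphericalFrac.IsBoundedOp (SphericalFrac.SMinus α) (SphericalFrac.RightFracExists α 1) p
        (SphericalFrac.weight n μ ν)
        (SphericalFrac.weight n (SphericalFrac.shiftedExp n p α μ ε) (ν - α))) := by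
  open SphericalFrac in
  obtain ⟨k, rfl⟩ := Nat.exists_eq_add_of_le' (one_le_two.trans hn)
  have h_shift (c : ℝ) : -((k + 1 : ℕ) / 2 * (1 / p).toReal) <
      shiftedExp (k + 1) p α c ε + α - α := by
    rw [add_sub_cancel_right]
    exact neg_lt_shiftedExp (k + 1) p α c hε
  refine ⟨fun hμ => ?_, fun hν => ?_⟩
  · have h_bdd := isBoundedOp_SPlus hn hα hμ (h_shift ν)
    rw [add_sub_cancel_right] at h_bdd
    exact h_bdd.weight_mono le_rfl (le_shiftedExp_add (k + 1) p α ν hε)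
  · have h_bdd := isBoundedOp_SMinus hn hα (h_shift μ) hν
    rw [add_sub_cancel_right] at h_bdd
    exact h_bdd.weight_mono (le_shiftedExp_add (k + 1) p α μ hε) le_rfl
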